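/- **Proposition (The page trick).** Let $V$ be a compact smooth manifold of dimension $n-1\ge 1$ with boundary $\partial V$, let $\phi$ be a diffeomorphism of $V$ that is the identity near $\partial V$, and let $N=\mathrm{OB}(V,\phi)$ be the closed smooth $n$-manifold with open book decomposition of page $V$ and monodromy $\phi$. That is, $N$ is the quotient of $V\times\mathbb R$ by $(x,t+1)\sim(\phi(x),t)$ for all $x$, and $(x,t)\sim(x,t')$ for $x\in\partial V$. Its smooth structure is that of the mapping torus of $\phi$ away from the binding (the image of $\partial V$) and that of $\partial V\times\mathbb D^2$ near the binding, where, for a collar $\partial V\times[0,1)\subset V$ on which $\phi$ is the identity, the class of $((b,r),t)$ is identified with $(b,re^{2\pi i t})$. (Equivalently, $N=\mathcal{MT}(V,\phi)\cup_{\mathrm{id},\partial}\partial V\times\mathbb D^2$.) Let $\iota:V\to N$, $\iota(x)=[(x,0)]$, be the embedding of $V$ as a page. Call a smooth embedding $h:V\to N\times[-1,1]$ a *Seifert type embedding of $V$ in $N\times[-1,0]\subset N\times[-1,1]$ with corner rounded inside $W$* (where $W\subset N\times[-1,1]$ is an open neighbourhood of the corner $\iota(\partial V)\times\{0\}$) if: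 1. there is a smooth isotopy of smooth embeddings $F_s:V\to N\times[-1,1]$, $s\in[0,1]$, with values in $N\times[-1,0]$, such that $F_0=(\iota,-1)$, $F_1=h$, $F_s=(\iota,-1)$ on $\partial V$ for all $s$, and $F_s$ maps the interior of $V$ into the interior of $N\times[-1,1]$ for all $s>0$; 2. $h(V)\subset\iota(V)\times[-1,0]$, and outside $W$ the image $h(V)$ coincides with $\iota(V)\times\{0\}\,\cup\,\iota(\partial V)\times[-1,0]$; that is, outside $W$ it meets $N\times\{0\}$ in $\iota(V)\times\{0\}$ and $N\times\{t\}$ in $\iota(\partial V)\times\{t\}$ for $-1\le t<0$. Then for every open neighbourhood $W$ of the corner there exist a Seifert type embedding $h$ of $V$ in $N\times[-1,0]\subset N\times[-1,1]$ with corner rounded inside $W$, and a smooth isotopy $\tilde\Gamma_s$ ($s\in[0,1]$) of $N\times[-1,1]$ through diffeomorphisms, fixing the boundary $N\times\{-1,1\}$ pointwise, such that $\tilde\Gamma_0=\mathrm{id}$ and $\tilde\Gamma_1\circ h=h\circ\phi$. -/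

import Mathlib

open Set
open scoped Manifold ContDiff Topology

instance fact_neg_one_lt_one : Fact ((-1 : ℝ) < 1) := ⟨by norm_num⟩

/-- A smooth embedding between finite-dimensional smooth manifolds (boundary and corners allowed):
a smooth map with everywhere injective differential that is a homeomorphism onto its image. -/
structure IsSmoothEmb {E H E' H' : Type*} [NormedAddCommGroup E] [NormedSpace ℝ E]
    [TopologicalSpace H] [NormedAddCommGroup E'] [NormedSpace ℝ E'] [TopologicalSpace H']
    (I : ModelWithCorners ℝ E H) (J : ModelWithCorners ℝ E' H')
    {X Y : Type*} [TopologicalSpace X] [ChartedSpace H X] [TopologicalSpace Y] [ChartedSpace H' Y]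
    (f : X → Y) : Prop where
  contMDiff : ContMDiff I J ∞ f
  injective_mfderiv : ∀ x, Function.Injective (mfderiv I J f x)
  isEmbedding : Topology.IsEmbedding f

/-- An identification of the manifold `N` of dimension `m + 2` with the open book `OB(V, φ)`, whose
page is the manifold with boundary `V` of dimension `m + 1`, whose binding is `B ≅ ∂V`, and whose
monodromy is the diffeomorphism `φ` of `V`.

As a set, `N` is `V × ℝ` modulo `(x, t + 1) ∼ (φ x, t)` for all `x` and `(x, t) ∼ (x, t')` for
`x ∈ ∂V`; the class of `(x, t)` is `map x t`. The smooth structure is the usual one: away from the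
binding it is that of the mapping torus of `φ`, and near the binding it is that of `B × 𝔻²`, glued
along a collar `B × [0, 1)` of `∂V` in `V` on which `φ` is the identity by means of polar
coordinates, `(b, r, t) ↦ (b, r exp (2 π i t))`. In particular, if `V₀` is `V` without the open
half collar `B × [0, 1/2)`, then `N` is the union of the mapping torus of the restriction of `φ` to
`V₀` and of `B × {|z| ≤ 1/2}`, glued by the identity along `∂V₀ × S¹ = B × {|z| = 1/2}`.
The pages are the sets `map V t`. -/
structure OpenBook (m : ℕ) (B V N : Type*)
    [TopologicalSpace B] [ChartedSpace (EuclideanSpace ℝ (Fin m)) B]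
    [TopologicalSpace V] [ChartedSpace (EuclideanHalfSpace (m + 1)) V]
    [TopologicalSpace N] [ChartedSpace (EuclideanSpace ℝ (Fin (m + 2))) N]
    (φ : V ≃ₘ^∞⟮𝓡∂ (m + 1), 𝓡∂ (m + 1)⟯ V) where
  /-- The collar `B × [0, 1) → V` of the boundary, a diffeomorphism onto an open set. -/
  collar : PartialDiffeomorph ((𝓡 m).prod (𝓡∂ 1)) (𝓡∂ (m + 1)) (B × unitInterval) V ∞
  collar_source : collar.source = {z | (z.2 : ℝ) < 1}
  boundary_eq : (𝓡∂ (m + 1)).boundary V = range fun b : B => collar (b, 0)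
  monodromy_collar : ∀ x ∈ collar.target, φ x = x
  /-- The quotient map `V × ℝ → N`. -/
  map : V → ℝ → N
  contMDiff_map :
    ContMDiff ((𝓡∂ (m + 1)).prod 𝓘(ℝ, ℝ)) (𝓡 (m + 2)) ∞ fun z : V × ℝ => map z.1 z.2
  map_surjective : ∀ y, ∃ x t, map x t = y
  map_add_one : ∀ x t, map x (t + 1) = map (φ x) t
  map_injective : ∀ x y, ∀ s ∈ Ico (0 : ℝ) 1, ∀ t ∈ Ico (0 : ℝ) 1, map x s = map y t →
    x = y ∧ (s = t ∨ x ∈ (𝓡∂ (m + 1)).boundary V)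
  isLocalDiffeomorphAt_map : ∀ x ∈ (𝓡∂ (m + 1)).interior V, ∀ t : ℝ,
    IsLocalDiffeomorphAt ((𝓡∂ (m + 1)).prod 𝓘(ℝ, ℝ)) (𝓡 (m + 2)) ∞
      (fun z : V × ℝ => map z.1 z.2) (x, t)
  /-- The tubular neighbourhood `B × {|z| < 1} → N` of the binding, a diffeomorphism onto an open
  set. -/
  tube : PartialDiffeomorph ((𝓡 m).prod 𝓘(ℝ, ℂ)) (𝓡 (m + 2)) (B × ℂ) N ∞
  tube_source : tube.source = {z | ‖z.2‖ < 1}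
  map_collar : ∀ (b : B) (r : unitInterval), (r : ℝ) < 1 → ∀ t : ℝ,
    map (collar (b, r)) t = tube (b, (r : ℂ) * Complex.exp (2 * Real.pi * t * Complex.I))

/-- The embedding of `V` in `N = OB(V, φ)` as a page. -/
def OpenBook.page {m : ℕ} {B V N : Type*}
    [TopologicalSpace B] [ChartedSpace (EuclideanSpace ℝ (Fin m)) B]
    [TopologicalSpace V] [ChartedSpace (EuclideanHalfSpace (m + 1)) V]
    [TopologicalSpace N] [ChartedSpace (EuclideanSpace ℝ (Fin (m + 2))) N]
    {φ : V ≃ₘ^∞⟮𝓡∂ (m + 1), 𝓡∂ (m + 1)⟯ V} (ob : OpenBook m B V N φ) : V → N :=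
  fun x => ob.map x 0

/-- The subset `ι(V) × {b} ∪ ι(∂V) × [a, b]` of `N × [a, c]`. -/
def seifertSet (m : ℕ) {V N : Type*}
    [TopologicalSpace V] [ChartedSpace (EuclideanHalfSpace (m + 1)) V]
    {a c : ℝ} (ι : V → N) (b : ℝ) : Set (N × Icc a c) :=
  {z | z.1 ∈ range ι ∧ (z.2 : ℝ) = b} ∪
    {z | z.1 ∈ ι '' (𝓡∂ (m + 1)).boundary V ∧ (z.2 : ℝ) ≤ b}

/-- The corner `ι(∂V) × {b}` of the set `ι(V) × {b} ∪ ι(∂V) × [a, b]`. -/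
def seifertCorner (m : ℕ) {V N : Type*}
    [TopologicalSpace V] [ChartedSpace (EuclideanHalfSpace (m + 1)) V]
    {a c : ℝ} (ι : V → N) (b : ℝ) : Set (N × Icc a c) :=
  {z | z.1 ∈ ι '' (𝓡∂ (m + 1)).boundary V ∧ (z.2 : ℝ) = b}

/-- `h` is a Seifert type embedding of `V` in `N × [a, b] ⊆ N × [a, c]`, corresponding to the
embedding `ι` of `V` in `N`, with its corner rounded inside `W`. It is the end of a smooth isotopy
of embeddings that starts at `ι` in the level `a`, pushes the interior of `V` into the interior of
`N × [a, c]` and fixes `∂V` pointwise. Its image is `ι(V) × {b} ∪ ι(∂V) × [a, b]`, that is, it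
meets the level `b` in `ι(V)` and each level `t ∈ [a, b)` in `ι(∂V)`, except inside `W`: there the
corner `ι(∂V) × {b}`, along which this set is not a smooth submanifold, is smoothed within
`ι(V) × [a, b]`. -/
structure IsSeifertTypeEmbedding (m : ℕ) {V N : Type*}
    [TopologicalSpace V] [ChartedSpace (EuclideanHalfSpace (m + 1)) V]
    [TopologicalSpace N] [ChartedSpace (EuclideanSpace ℝ (Fin (m + 2))) N]
    {a c : ℝ} [Fact (a < c)] (ι : V → N) (b : ℝ) (W : Set (N × Icc a c))
    (h : V → N × Icc a c) : Prop where
  exists_isotopy : ∃ F : unitInterval → V → N × Icc a c,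
    ContMDiff ((𝓡∂ 1).prod (𝓡∂ (m + 1))) ((𝓡 (m + 2)).prod (𝓡∂ 1)) ∞
      (fun z : unitInterval × V => F z.1 z.2) ∧
    (∀ s, IsSmoothEmb (𝓡∂ (m + 1)) ((𝓡 (m + 2)).prod (𝓡∂ 1)) (F s)) ∧
    (∀ x, (F 0 x).1 = ι x ∧ ((F 0 x).2 : ℝ) = a) ∧
    (∀ s, ∀ x ∈ (𝓡∂ (m + 1)).boundary V, (F s x).1 = ι x ∧ ((F s x).2 : ℝ) = a) ∧
    (∀ s, 0 < s → ∀ x ∈ (𝓡∂ (m + 1)).interior V,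
      F s x ∈ ((𝓡 (m + 2)).prod (𝓡∂ 1)).interior (N × Icc a c)) ∧
    (∀ s x, ((F s x).2 : ℝ) ≤ b) ∧
    F 1 = h
  fst_mem : ∀ x, (h x).1 ∈ range ι
  range_diff : range h \ W = seifertSet m ι b \ W

/-- A smooth isotopy `Γ_s`, `s ∈ [0, 1]`, of a manifold, relative to its boundary: a smooth family
of diffeomorphisms, each of which fixes the boundary pointwise. -/
structure IsIsotopyRelBoundary {E H : Type*} [NormedAddCommGroup E] [NormedSpace ℝ E]
    [TopologicalSpace H] (J : ModelWithCorners ℝ E H)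
    {X : Type*} [TopologicalSpace X] [ChartedSpace H X]
    (Γ : unitInterval → X ≃ₘ^∞⟮J, J⟯ X) : Prop where
  contMDiff : ContMDiff ((𝓡∂ 1).prod J) J ∞ fun z : unitInterval × X => Γ z.1 z.2
  fixes_boundary : ∀ s, ∀ x ∈ J.boundary X, Γ s x = x

/-! Shifting the time coordinate by `u` gives a smooth flow on the open book. It fixes the binding,
rotates its tubular neighbourhood by the angle `2πu`, and at time one carries the zero page to
itself by the monodromy (`flow_one_page`), because `(x, 1)` and `(φ x, 0)` are the same point. In
the product with `[-1, 1]` one runs this flow in every level, for a time damped by a function of the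
level that vanishes at both ends and is `1` near level `0` (`rotation`). This is an isotopy relative
to the boundary.

The embedding is the page at level `0` with a collar of its boundary bent down along the binding to
level `-1`. It has three pieces. On the flat piece, at level `0`, the time-one flow is `φ`. The
vertical piece lies over the binding, which the flow fixes for all times, so the damping does no
harm there. The rounded piece lies at levels where the damping function is still `1`; there the flow
makes a full turn of the tube, which is the identity, and so is `φ` on the collar. Together these
give `rotation_one_seifertIsotopy`.

The bent page is built from a plane curve in the collar coordinate, and the required isotopy of
embeddings is the straight-line homotopy from the level `-1` to this curve. It stays injective and
immersive because one of its two coordinates always increases (`segment_strictMono`,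
`segment_deriv_ne_zero`). -/

namespace OpenBook

/-! ### The flow of an open book -/

variable {m : ℕ} {B V N : Type*}
    [TopologicalSpace B] [ChartedSpace (EuclideanSpace ℝ (Fin m)) B]
    [TopologicalSpace V] [ChartedSpace (EuclideanHalfSpace (m + 1)) V]
    [TopologicalSpace N] [ChartedSpace (EuclideanSpace ℝ (Fin (m + 2))) N]
    {φ : V ≃ₘ^∞⟮𝓡∂ (m + 1), 𝓡∂ (m + 1)⟯ V} (ob : OpenBook m B V N φ)

theorem mem_collar_source {b : B} {r : unitInterval} (hr : (r : ℝ) < 1) :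
    (b, r) ∈ ob.collar.source := by
  rw [ob.collar_source]
  exact hr

theorem collar_mem_target {b : B} {r : unitInterval} (hr : (r : ℝ) < 1) :
    ob.collar (b, r) ∈ ob.collar.target :=
  ob.collar.map_source (ob.mem_collar_source hr)

theorem mem_tube_source {b : B} {z : ℂ} (hz : ‖z‖ < 1) : (b, z) ∈ ob.tube.source := by
  rw [ob.tube_source]
  exact hz

theorem boundary_subset_collar_target : (𝓡∂ (m + 1)).boundary V ⊆ ob.collar.target := by
  rw [ob.boundary_eq]
  rintro _ ⟨b, rfl⟩
  exact ob.collar_mem_target (by simp)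

theorem map_boundary {x : V} (hx : x ∈ (𝓡∂ (m + 1)).boundary V) (s t : ℝ) :
    ob.map x s = ob.map x t := by
  rw [ob.boundary_eq] at hx
  obtain ⟨b, rfl⟩ := hx
  rw [ob.map_collar b 0 (by simp), ob.map_collar b 0 (by simp)]
  simp

theorem map_add_int (x : V) (t : ℝ) (k : ℤ) :
    ob.map x (t + k) = ob.map ((φ.toEquiv ^ k) x) t := by
  have key : ∀ (n : ℕ) (x : V) (t : ℝ), ob.map x (t + n) = ob.map ((φ.toEquiv ^ n) x) t := by
    intro n
    induction n with
    | zero => simp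
    | succ n ih =>
      intro x t
      rw [Nat.cast_succ, ← add_assoc, ob.map_add_one, ih, pow_succ]
      rfl
  obtain ⟨n, rfl | rfl⟩ := k.eq_nat_or_neg
  · simpa using key n x t
  -- A negative exponent reduces to a natural one by starting from the shifted point and time.
  · have h := key n ((φ.toEquiv ^ (-(n : ℤ))) x) (t + ((-(n : ℤ) : ℤ) : ℝ))
    rw [← Equiv.Perm.mul_apply, ← zpow_natCast, ← zpow_add] at h
    simpa using h.symm

theorem map_eq_map_fract (x : V) (t u : ℝ) :
    ob.map x (t + u) = ob.map ((φ.toEquiv ^ ⌊t⌋) x) (Int.fract t + u) := by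
  rw [← ob.map_add_int]
  congr 1
  rw [← Int.self_sub_floor]
  ring

/-- This makes the flow independent of the chosen representative. Moving both times into `[0, 1)` by
powers of `φ` leaves only the coincidences allowed by `map_injective`: equal times, or a boundary
point, for which time is irrelevant. -/
theorem map_add_eq_of_map_eq {x y : V} {s t : ℝ} (h : ob.map x s = ob.map y t) (u : ℝ) :
    ob.map x (s + u) = ob.map y (t + u) := by
  rw [ob.map_eq_map_fract x, ob.map_eq_map_fract y]
  have h' : ob.map ((φ.toEquiv ^ ⌊s⌋) x) (Int.fract s) =
      ob.map ((φ.toEquiv ^ ⌊t⌋) y) (Int.fract t) := by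
    simpa [ob.map_eq_map_fract _ _ 0] using
      ((ob.map_eq_map_fract x s 0).symm.trans ((by simpa using h) : _)).trans
        (ob.map_eq_map_fract y t 0)
  obtain ⟨h1, h2⟩ := ob.map_injective _ _ _ ⟨Int.fract_nonneg s, Int.fract_lt_one s⟩ _
    ⟨Int.fract_nonneg t, Int.fract_lt_one t⟩ h'
  rw [← h1]
  rcases h2 with h2 | h2
  · rw [h2]
  · exact ob.map_boundary h2 _ _

/-- The flow on an open book that moves the pages: the class of `(x, t)` goes to that of
`(x, t + u)`. -/
noncomputable def flow (u : ℝ) (y : N) : N :=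
  ob.map (ob.map_surjective y).choose ((ob.map_surjective y).choose_spec.choose + u)

theorem flow_map (u : ℝ) (x : V) (t : ℝ) : ob.flow u (ob.map x t) = ob.map x (t + u) :=
  ob.map_add_eq_of_map_eq (ob.map_surjective (ob.map x t)).choose_spec.choose_spec u

theorem flow_zero (y : N) : ob.flow 0 y = y := by
  obtain ⟨x, t, rfl⟩ := ob.map_surjective y
  rw [flow_map, add_zero]

theorem flow_flow (u v : ℝ) (y : N) : ob.flow u (ob.flow v y) = ob.flow (v + u) y := by
  obtain ⟨x, t, rfl⟩ := ob.map_surjective y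
  rw [flow_map, flow_map, flow_map, add_assoc]

theorem flow_one_page (x : V) : ob.flow 1 (ob.page x) = ob.page (φ x) := by
  rw [page, page, flow_map, ob.map_add_one]

theorem page_collar {b : B} {r : unitInterval} (hr : (r : ℝ) < 1) :
    ob.page (ob.collar (b, r)) = ob.tube (b, ((r : ℝ) : ℂ)) := by
  simp [page, ob.map_collar b r hr]

/-- Polar coordinates: `z` is the collar point of radius `‖z‖` at time `arg z / 2π`, and adding `u`
to the time multiplies by a phase. The resulting formula is smooth in `z` across the binding, where
polar coordinates degenerate. -/
theorem flow_tube (u : ℝ) (b : B) {z : ℂ} (hz : ‖z‖ < 1) :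
    ob.flow u (ob.tube (b, z)) = ob.tube (b, z * Complex.exp (2 * Real.pi * u * Complex.I)) := by
  have key : ∀ v : ℝ, ob.map (ob.collar (b, ⟨‖z‖, norm_nonneg z, hz.le⟩))
      (z.arg / (2 * Real.pi) + v) =
        ob.tube (b, z * Complex.exp (2 * Real.pi * v * Complex.I)) := by
    intro v
    have hpi : (Real.pi : ℂ) ≠ 0 := by exact_mod_cast Real.pi_ne_zero
    have harg : (2 * Real.pi * (z.arg / (2 * Real.pi) + v : ℝ) * Complex.I : ℂ) =
        z.arg * Complex.I + 2 * Real.pi * v * Complex.I := by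
      push_cast
      field_simp
    have hz' : z * Complex.exp (2 * Real.pi * v * Complex.I) =
        ‖z‖ * Complex.exp (2 * Real.pi * (z.arg / (2 * Real.pi) + v : ℝ) * Complex.I) := by
      rw [harg, Complex.exp_add, ← mul_assoc, Complex.norm_mul_exp_arg_mul_I]
    rw [ob.map_collar b _ hz, hz']
  have h0 := key 0
  simp only [Complex.ofReal_zero, mul_zero, zero_mul, Complex.exp_zero, mul_one] at h0
  rw [← h0, flow_map, add_zero, key]

theorem flow_tube_zero (u : ℝ) (b : B) : ob.flow u (ob.tube (b, 0)) = ob.tube (b, 0) := by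
  simpa using ob.flow_tube u b (z := 0) (by simp)

/-- Over an interior point of the page, the quotient map has a smooth local inverse, and in these
coordinates the flow is a translation of time. At the binding there is no such inverse; the tube is
used instead, where the flow is a rotation. -/
theorem contMDiff_flow :
    ContMDiff (𝓘(ℝ, ℝ).prod (𝓡 (m + 2))) (𝓡 (m + 2)) ∞
      fun p : ℝ × N => ob.flow p.1 p.2 := by
  rintro ⟨u₀, y₀⟩
  obtain ⟨x, t, rfl⟩ := ob.map_surjective y₀
  by_cases hx : x ∈ (𝓡∂ (m + 1)).interior V
  · have h := ob.isLocalDiffeomorphAt_map x hx t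
    have hinv := h.localInverse_contMDiffAt
    have hev : ∀ᶠ p : ℝ × N in 𝓝 (u₀, ob.map x t), ob.flow p.1 p.2 =
        ob.map (h.localInverse p.2).1 ((h.localInverse p.2).2 + p.1) := by
      have hmem : ∀ᶠ p : ℝ × N in 𝓝 (u₀, ob.map x t), p.2 ∈ h.localInverse.source :=
        continuous_snd.continuousAt.eventually
          (h.localInverse_open_source.mem_nhds h.localInverse_mem_source)
      filter_upwards [hmem] with p hp
      rw [← ob.flow_map]
      exact congrArg _ (h.localInverse_right_inv hp).symm
    refine ContMDiffAt.congr_of_eventuallyEq ?_ hev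
    have h1 : ContMDiffAt (𝓘(ℝ, ℝ).prod (𝓡 (m + 2))) ((𝓡∂ (m + 1)).prod 𝓘(ℝ, ℝ)) ∞
        (fun p : ℝ × N => h.localInverse p.2) (u₀, ob.map x t) :=
      ContMDiffAt.comp (g := h.localInverse) (f := Prod.snd) (u₀, ob.map x t) hinv
        contMDiffAt_snd
    have h2 : ContMDiffAt (𝓘(ℝ, ℝ).prod (𝓡 (m + 2))) ((𝓡∂ (m + 1)).prod 𝓘(ℝ, ℝ)) ∞
        (fun p : ℝ × N => ((h.localInverse p.2).1, (h.localInverse p.2).2 + p.1))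
        (u₀, ob.map x t) :=
      h1.fst.prodMk (h1.snd.add contMDiffAt_fst)
    exact ContMDiffAt.comp (g := fun z : V × ℝ => ob.map z.1 z.2) _
      (ob.contMDiff_map.contMDiffAt) h2
  · have hb : x ∈ (𝓡∂ (m + 1)).boundary V := by
      rw [← ModelWithCorners.compl_interior]
      exact hx
    rw [ob.boundary_eq] at hb
    obtain ⟨b, rfl⟩ := hb
    have h0 : ob.map (ob.collar (b, 0)) t = ob.tube (b, 0) := by
      simp [ob.map_collar b 0 (by simp) t]
    rw [h0]
    have hs := ob.mem_tube_source (b := b) (z := 0) (by simp)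
    have ht : ob.tube (b, 0) ∈ ob.tube.target := ob.tube.map_source hs
    have hsymm0 : ob.tube.symm (ob.tube (b, 0)) = (b, 0) := ob.tube.left_inv hs
    have hev : ∀ᶠ p : ℝ × N in 𝓝 (u₀, ob.tube (b, 0)), ob.flow p.1 p.2 =
        ob.tube ((ob.tube.symm p.2).1,
          (ob.tube.symm p.2).2 * Complex.exp (2 * Real.pi * p.1 * Complex.I)) := by
      have hmem : ∀ᶠ p : ℝ × N in 𝓝 (u₀, ob.tube (b, 0)), p.2 ∈ ob.tube.target :=
        continuous_snd.continuousAt.eventually (ob.tube.open_target.mem_nhds ht)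
      filter_upwards [hmem] with p hp
      have h1 : ob.tube.symm p.2 ∈ ob.tube.source := ob.tube.map_target hp
      rw [ob.tube_source] at h1
      rw [← ob.flow_tube _ _ h1]
      exact congrArg _ (ob.tube.right_inv hp).symm
    refine ContMDiffAt.congr_of_eventuallyEq ?_ hev
    have hinv : ContMDiffAt (𝓡 (m + 2)) ((𝓡 m).prod 𝓘(ℝ, ℂ)) ∞ ob.tube.symm (ob.tube (b, 0)) :=
      ob.tube.symm.contMDiffOn.contMDiffAt (ob.tube.open_target.mem_nhds ht)
    have h1 : ContMDiffAt (𝓘(ℝ, ℝ).prod (𝓡 (m + 2))) ((𝓡 m).prod 𝓘(ℝ, ℂ)) ∞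
        (fun p : ℝ × N => ob.tube.symm p.2) (u₀, ob.tube (b, 0)) :=
      ContMDiffAt.comp (g := ob.tube.symm) (f := Prod.snd) (u₀, ob.tube (b, 0)) hinv
        contMDiffAt_snd
    have hexp : ContDiff ℝ ∞ fun q : ℂ × ℝ =>
        q.1 * Complex.exp (2 * Real.pi * q.2 * Complex.I) := by
      have : ContDiff ℝ ∞ fun q : ℂ × ℝ => (q.2 : ℂ) :=
        Complex.ofRealCLM.contDiff.comp contDiff_snd
      exact contDiff_fst.mul ((contDiff_const.mul this).mul contDiff_const).cexp
    have h2 : ContMDiffAt (𝓘(ℝ, ℝ).prod (𝓡 (m + 2))) 𝓘(ℝ, ℂ) ∞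
        (fun p : ℝ × N => (ob.tube.symm p.2).2 * Complex.exp (2 * Real.pi * p.1 * Complex.I))
        (u₀, ob.tube (b, 0)) :=
      ContMDiffAt.comp (I' := 𝓘(ℝ, ℂ × ℝ))
        (g := fun q : ℂ × ℝ => q.1 * Complex.exp (2 * Real.pi * q.2 * Complex.I))
        (f := fun p : ℝ × N => ((ob.tube.symm p.2).2, p.1)) _
        hexp.contMDiff.contMDiffAt (h1.snd.prodMk_space contMDiffAt_fst)
    refine ContMDiffAt.comp_of_eq (g := ob.tube) (x := (u₀, ob.tube (b, 0)))
      (y := (b, (0 : ℂ))) ?_ (h1.fst.prodMk h2) ?_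
    · exact ob.tube.contMDiffOn.contMDiffAt (ob.tube.open_source.mem_nhds hs)
    · change ((ob.tube.symm (ob.tube (b, 0))).1, (ob.tube.symm (ob.tube (b, 0))).2 *
        Complex.exp (2 * Real.pi * u₀ * Complex.I)) = (b, 0)
      rw [hsymm0, zero_mul]

end OpenBook

/-! ### Plane curves that round the corner -/

/-- The first coordinate of a rounded corner, a curve that runs along the second axis for `r ≤ d`
and along the first axis for `r ≥ 2 * d`. -/
noncomputable def cornerFst (d r : ℝ) : ℝ := r * Real.smoothTransition ((r - d) / d)

/-- The second coordinate of a rounded corner. -/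
noncomputable def cornerSnd (d k r : ℝ) : ℝ :=
  -(Real.exp (-(k * r)) * (1 - Real.smoothTransition ((r - d) / d)))

/-- The first coordinate of the line segment from `(r, -1)` to the point of parameter `r` of a
rounded corner. -/
noncomputable def segmentFst (d s r : ℝ) : ℝ := (1 - s) * r + s * cornerFst d r

/-- The second coordinate of the line segment from `(r, -1)` to the point of parameter `r` of a
rounded corner. -/
noncomputable def segmentSnd (d k s r : ℝ) : ℝ := -(1 - s) + s * cornerSnd d k r

section

variable {d k s r r' : ℝ}

theorem smoothTransition_corner_mono (hd : 0 < d) (h : r ≤ r') :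
    Real.smoothTransition ((r - d) / d) ≤ Real.smoothTransition ((r' - d) / d) :=
  Real.smoothTransition.monotone (by gcongr)

theorem smoothTransition_corner_of_le (hd : 0 < d) (h : r ≤ d) :
    Real.smoothTransition ((r - d) / d) = 0 :=
  Real.smoothTransition.zero_of_nonpos (div_nonpos_of_nonpos_of_nonneg (by linarith) hd.le)

theorem smoothTransition_corner_of_ge (hd : 0 < d) (h : 2 * d ≤ r) :
    Real.smoothTransition ((r - d) / d) = 1 :=
  Real.smoothTransition.one_of_one_le ((one_le_div hd).2 (by linarith))

theorem cornerFst_of_le (hd : 0 < d) (h : r ≤ d) : cornerFst d r = 0 := by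
  rw [cornerFst, smoothTransition_corner_of_le hd h, mul_zero]

theorem cornerFst_of_ge (hd : 0 < d) (h : 2 * d ≤ r) : cornerFst d r = r := by
  rw [cornerFst, smoothTransition_corner_of_ge hd h, mul_one]

theorem cornerSnd_of_le (hd : 0 < d) (h : r ≤ d) : cornerSnd d k r = -Real.exp (-(k * r)) := by
  rw [cornerSnd, smoothTransition_corner_of_le hd h, sub_zero, mul_one]

theorem cornerSnd_of_ge (hd : 0 < d) (h : 2 * d ≤ r) : cornerSnd d k r = 0 := by
  rw [cornerSnd, smoothTransition_corner_of_ge hd h, sub_self, mul_zero, neg_zero]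

theorem cornerFst_nonneg (hr : 0 ≤ r) : 0 ≤ cornerFst d r :=
  mul_nonneg hr (Real.smoothTransition.nonneg _)

theorem cornerFst_le (hr : 0 ≤ r) : cornerFst d r ≤ r :=
  mul_le_of_le_one_right hr (Real.smoothTransition.le_one _)

theorem cornerSnd_nonpos : cornerSnd d k r ≤ 0 :=
  neg_nonpos.2 (mul_nonneg (Real.exp_nonneg _) (sub_nonneg.2 (Real.smoothTransition.le_one _)))

/-- Controls the depth of the rounding: for `r ≥ d` and `k > 0` the curve stays above `-exp (-(k *
d))`, which a large `k` brings as close to `0` as needed. -/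
theorem neg_exp_le_cornerSnd : -Real.exp (-(k * r)) ≤ cornerSnd d k r :=
  neg_le_neg (mul_le_of_le_one_right (Real.exp_nonneg _)
    (by linarith [Real.smoothTransition.nonneg ((r - d) / d)]))

theorem neg_one_le_cornerSnd (hk : 0 < k) (hr : 0 ≤ r) : -1 ≤ cornerSnd d k r := by
  have : Real.exp (-(k * r)) ≤ 1 := Real.exp_le_one_iff.2 (by nlinarith)
  linarith [neg_exp_le_cornerSnd (d := d) (k := k) (r := r)]

theorem neg_one_lt_cornerSnd (hk : 0 < k) (hr : 0 < r) : -1 < cornerSnd d k r := by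
  have : Real.exp (-(k * r)) < 1 := Real.exp_lt_one_iff.2 (by nlinarith)
  linarith [neg_exp_le_cornerSnd (d := d) (k := k) (r := r)]

theorem cornerFst_mono (hd : 0 < d) (hr : 0 ≤ r) (h : r ≤ r') : cornerFst d r ≤ cornerFst d r' :=
  mul_le_mul h (smoothTransition_corner_mono hd h) (Real.smoothTransition.nonneg _) (hr.trans h)

/-- If the cutoff vanishes at `r'`, both points are on the vertical part and the exponential
separates them; otherwise the product of `r` with the cutoff strictly increases. -/
theorem corner_strictMono (hd : 0 < d) (hk : 0 < k) (hr : 0 ≤ r) (h : r < r') :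
    cornerFst d r < cornerFst d r' ∨ cornerSnd d k r < cornerSnd d k r' := by
  rcases (Real.smoothTransition.nonneg ((r' - d) / d)).eq_or_lt with h0 | h0
  · right
    have h1 : Real.smoothTransition ((r - d) / d) = 0 :=
      le_antisymm (h0 ▸ smoothTransition_corner_mono hd h.le) (Real.smoothTransition.nonneg _)
    simp only [cornerSnd, h1, ← h0, sub_zero, mul_one, neg_lt_neg_iff, Real.exp_lt_exp]
    exact mul_lt_mul_of_pos_left h hk
  · left
    exact (mul_le_mul_of_nonneg_left (smoothTransition_corner_mono hd h.le) hr).trans_lt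
      (mul_lt_mul_of_pos_right h h0)

theorem segmentFst_zero_left : segmentFst d 0 r = r := by simp [segmentFst]

theorem segmentFst_of_ge (hd : 0 < d) (h : 2 * d ≤ r) : segmentFst d s r = r := by
  rw [segmentFst, cornerFst_of_ge hd h]
  ring

theorem segmentSnd_of_ge (hd : 0 < d) (h : 2 * d ≤ r) : segmentSnd d k s r = -(1 - s) := by
  rw [segmentSnd, cornerSnd_of_ge hd h, mul_zero, add_zero]

theorem segmentFst_nonneg (hs : s ∈ Icc (0 : ℝ) 1) (hr : 0 ≤ r) : 0 ≤ segmentFst d s r :=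
  add_nonneg (mul_nonneg (by linarith [hs.2]) hr) (mul_nonneg hs.1 (cornerFst_nonneg hr))

theorem segmentFst_le (hs : s ∈ Icc (0 : ℝ) 1) (hr : 0 ≤ r) : segmentFst d s r ≤ r := by
  have := mul_le_mul_of_nonneg_left (cornerFst_le (d := d) hr) hs.1
  rw [segmentFst]
  linarith

theorem neg_one_le_segmentSnd (hk : 0 < k) (hs : s ∈ Icc (0 : ℝ) 1) (hr : 0 ≤ r) :
    -1 ≤ segmentSnd d k s r := by
  have := mul_le_mul_of_nonneg_left (neg_one_le_cornerSnd (d := d) hk hr) hs.1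
  rw [segmentSnd]
  linarith

theorem neg_one_lt_segmentSnd (hk : 0 < k) (hs : 0 < s) (hr : 0 < r) :
    -1 < segmentSnd d k s r := by
  have := mul_lt_mul_of_pos_left (neg_one_lt_cornerSnd (d := d) hk hr) hs
  rw [segmentSnd]
  linarith

theorem segmentSnd_nonpos (hs : s ∈ Icc (0 : ℝ) 1) : segmentSnd d k s r ≤ 0 := by
  have := mul_nonpos_of_nonneg_of_nonpos hs.1 (cornerSnd_nonpos (d := d) (k := k) (r := r))
  rw [segmentSnd]
  linarith [hs.2]

theorem segment_strictMono (hd : 0 < d) (hk : 0 < k) (hs : s ∈ Icc (0 : ℝ) 1) (hr : 0 ≤ r)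
    (h : r < r') : segmentFst d s r < segmentFst d s r' ∨
      segmentSnd d k s r < segmentSnd d k s r' := by
  have h1 := mul_le_mul_of_nonneg_left (cornerFst_mono hd hr h.le) hs.1
  have h2 : (1 - s) * r ≤ (1 - s) * r' := mul_le_mul_of_nonneg_left h.le (by linarith [hs.2])
  simp only [segmentFst, segmentSnd]
  rcases hs.1.eq_or_lt with rfl | hs0
  · left
    linarith
  · rcases corner_strictMono hd hk hr h with h | h
    · left
      linarith [mul_lt_mul_of_pos_left h hs0]
    · right
      linarith [mul_lt_mul_of_pos_left h hs0]

theorem segment_injective (hd : 0 < d) (hk : 0 < k) (hs : s ∈ Icc (0 : ℝ) 1) (hr : 0 ≤ r)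
    (hr' : 0 ≤ r') (h1 : segmentFst d s r = segmentFst d s r')
    (h2 : segmentSnd d k s r = segmentSnd d k s r') : r = r' := by
  rcases lt_trichotomy r r' with h | h | h
  · rcases segment_strictMono hd hk hs hr h with h | h <;> linarith
  · exact h
  · rcases segment_strictMono hd hk hs hr' h with h | h <;> linarith

theorem contDiff_smoothTransition_corner :
    ContDiff ℝ ∞ fun r => Real.smoothTransition ((r - d) / d) :=
  Real.smoothTransition.contDiff.comp ((contDiff_id.sub contDiff_const).div_const d)

theorem contDiff_segmentFst : ContDiff ℝ ∞ fun p : ℝ × ℝ => segmentFst d p.1 p.2 := by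
  have h : ContDiff ℝ ∞ fun p : ℝ × ℝ => cornerFst d p.2 :=
    contDiff_snd.mul (contDiff_smoothTransition_corner.comp contDiff_snd)
  exact ((contDiff_const.sub contDiff_fst).mul contDiff_snd).add (contDiff_fst.mul h)

theorem contDiff_segmentSnd : ContDiff ℝ ∞ fun p : ℝ × ℝ => segmentSnd d k p.1 p.2 := by
  have h : ContDiff ℝ ∞ fun p : ℝ × ℝ => cornerSnd d k p.2 :=
    ((contDiff_const.mul contDiff_snd).neg.exp.mul
      (contDiff_const.sub (contDiff_smoothTransition_corner.comp contDiff_snd))).neg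
  exact (contDiff_const.sub contDiff_fst).neg.add (contDiff_fst.mul h)

/-- Infinitesimal form of `segment_strictMono`, with the same dichotomy: where the cutoff vanishes,
the exponential gives the second coordinate positive speed if `s > 0`; where it is positive, the
first coordinate has positive speed. At `s = 0` the first coordinate is `r` itself. -/
theorem segment_deriv_ne_zero (hd : 0 < d) (hk : 0 < k) (hs : s ∈ Icc (0 : ℝ) 1) (hr : 0 ≤ r) :
    deriv (segmentFst d s) r ≠ 0 ∨ deriv (segmentSnd d k s) r ≠ 0 := by
  set f := fun r => Real.smoothTransition ((r - d) / d) with hf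
  have hdf : HasDerivAt f (deriv f r) r :=
    (contDiff_smoothTransition_corner.differentiable (by simp) r).hasDerivAt
  have hf0 : 0 ≤ deriv f r :=
    Monotone.deriv_nonneg fun a b h => smoothTransition_corner_mono hd h
  have h1 : HasDerivAt (segmentFst d s) ((1 - s) * 1 + s * (1 * f r + r * deriv f r)) r :=
    ((hasDerivAt_id r).const_mul (1 - s)).add (((hasDerivAt_id r).mul hdf).const_mul s)
  have h2 : HasDerivAt (segmentSnd d k s)
      (s * -(Real.exp (-(k * r)) * -(k * 1) * (1 - f r) + Real.exp (-(k * r)) * -deriv f r)) r :=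
    (((((hasDerivAt_id r).const_mul k).neg.exp.mul (hdf.const_sub 1)).neg).const_mul s).const_add _
  rw [h1.deriv, h2.deriv]
  have hfr : 0 ≤ f r := Real.smoothTransition.nonneg _
  have hrf : 0 ≤ r * deriv f r := mul_nonneg hr hf0
  rcases hs.1.eq_or_lt with rfl | hs0
  · left
    simp
  rcases hfr.eq_or_lt with h0 | h0
  · right
    rw [← h0]
    have he := Real.exp_pos (-(k * r))
    have : 0 < s * (Real.exp (-(k * r)) * k + Real.exp (-(k * r)) * deriv f r) := by positivity
    refine ne_of_gt (this.trans_eq ?_)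
    ring
  · left
    have : 0 < s * (1 * f r + r * deriv f r) := by positivity
    linarith [hs.2]

end

/-! ### Kernels of differentials -/

section

variable {E H E' H' E₂ H₂ : Type*} [NormedAddCommGroup E] [NormedSpace ℝ E]
  [TopologicalSpace H] [NormedAddCommGroup E'] [NormedSpace ℝ E'] [TopologicalSpace H']
  [NormedAddCommGroup E₂] [NormedSpace ℝ E₂] [TopologicalSpace H₂]
  {I : ModelWithCorners ℝ E H} {J : ModelWithCorners ℝ E' H'} {K : ModelWithCorners ℝ E₂ H₂}
  {X Y Z : Type*} [TopologicalSpace X] [ChartedSpace H X] [TopologicalSpace Y]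
  [ChartedSpace H' Y] [TopologicalSpace Z] [ChartedSpace H₂ Z]

/-- A vector killed by the differential of `f` is killed by that of any map that factors through
`f` near the point. -/
theorem mfderiv_apply_eq_zero_of_comp {f : X → Y} {g : Y → Z} {p : X → Z} {x : X}
    {v : TangentSpace I x} (hf : MDifferentiableAt I J f x)
    (hg : MDifferentiableAt J K g (f x)) (h : g ∘ f =ᶠ[𝓝 x] p) (hv : mfderiv I J f x v = 0) :
    mfderiv I K p x v = 0 := by
  have h1 : mfderiv I K (g ∘ f) x v = 0 := by
    rw [mfderiv_comp_apply x hg hf, hv, map_zero]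
  rw [← h.mfderiv_eq]
  exact h1

/-- The differential of a map with a local left inverse is injective. -/
theorem eq_zero_of_mfderiv_apply_eq_zero_of_leftInverse {f : X → Y} {g : Y → X} {x : X}
    {v : TangentSpace I x} (hf : MDifferentiableAt I J f x)
    (hg : MDifferentiableAt J I g (f x)) (h : g ∘ f =ᶠ[𝓝 x] id) (hv : mfderiv I J f x v = 0) :
    v = 0 := by
  have := mfderiv_apply_eq_zero_of_comp hf hg h hv
  rwa [mfderiv_id] at this

theorem contMDiff_projIcc_comp {a c : ℝ} [Fact (a < c)] {f : X → ℝ}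
    (hf : ContMDiff I 𝓘(ℝ, ℝ) ∞ f) (hmem : ∀ x, f x ∈ Icc a c) :
    ContMDiff I (𝓡∂ 1) ∞ fun x => projIcc a c (Fact.out : a < c).le (f x) :=
  contMDiffOn_projIcc.comp_contMDiff hf hmem

theorem mfderiv_apply_eq_zero_of_deriv_ne_zero {f : X → ℝ} {g : ℝ → ℝ} {x : X}
    {v : TangentSpace I x} (hf : MDifferentiableAt I 𝓘(ℝ, ℝ) f x)
    (hg : DifferentiableAt ℝ g (f x)) (hne : deriv g (f x) ≠ 0)
    (hv : mfderiv I 𝓘(ℝ, ℝ) (g ∘ f) x v = 0) : mfderiv I 𝓘(ℝ, ℝ) f x v = 0 := by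
  rw [mfderiv_comp_apply x hg.mdifferentiableAt hf, mfderiv_eq_fderiv] at hv
  have h := (fderiv_eq_smul_deriv (f := g) (x := f x) (mfderiv I 𝓘(ℝ, ℝ) f x v : ℝ)).symm.trans hv
  exact (smul_eq_zero.1 h).resolve_right hne

/-- The projection to the interval is a left inverse of the inclusion, but is known to be smooth
only on the closed interval; hence the chain rule is applied with derivatives within that set. -/
theorem injective_mfderiv_subtypeVal_Icc {a c : ℝ} [Fact (a < c)] (z : Icc a c)
    {v : TangentSpace (𝓡∂ 1) z}
    (hv : mfderiv (𝓡∂ 1) 𝓘(ℝ, ℝ) (Subtype.val : Icc a c → ℝ) z v = 0) : v = 0 := by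
  have h1 : MDifferentiableAt (𝓡∂ 1) 𝓘(ℝ, ℝ) (Subtype.val : Icc a c → ℝ) z :=
    contMDiff_subtypeVal_Icc.mdifferentiable (n := ∞) (by simp) z
  have h2 : MDifferentiableWithinAt 𝓘(ℝ, ℝ) (𝓡∂ 1) (projIcc a c (Fact.out : a < c).le)
      (Icc a c) z :=
    (contMDiffOn_projIcc (n := ∞)).mdifferentiableOn (by simp) z z.2
  have h3 := mfderivWithin_comp z h2 h1.mdifferentiableWithinAt (fun w _ => w.2)
    (uniqueMDiffWithinAt_univ _)
  have h4 : projIcc a c (Fact.out : a < c).le ∘ (Subtype.val : Icc a c → ℝ) = id :=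
    funext fun w => projIcc_val _ w
  rw [h4, mfderivWithin_univ, mfderivWithin_univ, mfderiv_id] at h3
  have h5 : v = mfderivWithin 𝓘(ℝ, ℝ) (𝓡∂ 1) (projIcc a c (Fact.out : a < c).le) (Icc a c) z
      (mfderiv (𝓡∂ 1) 𝓘(ℝ, ℝ) (Subtype.val : Icc a c → ℝ) z v) := congrArg (fun L => L v) h3
  rw [hv] at h5
  exact h5.trans (map_zero _)

end

/-! ### The isotopy that bends the page down along its collar -/

namespace OpenBook

variable {m : ℕ} {B V N : Type*}
    [TopologicalSpace B] [ChartedSpace (EuclideanSpace ℝ (Fin m)) B]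
    [TopologicalSpace V] [ChartedSpace (EuclideanHalfSpace (m + 1)) V]
    [TopologicalSpace N] [ChartedSpace (EuclideanSpace ℝ (Fin (m + 2))) N]
    {φ : V ≃ₘ^∞⟮𝓡∂ (m + 1), 𝓡∂ (m + 1)⟯ V} (ob : OpenBook m B V N φ)

/-- The point of the binding below a point of the collar. -/
noncomputable def base (x : V) : B := (ob.collar.symm x).1

/-- The collar coordinate of a point of the collar. -/
noncomputable def radius (x : V) : ℝ := ((ob.collar.symm x).2 : ℝ)

theorem radius_nonneg (x : V) : 0 ≤ ob.radius x := (ob.collar.symm x).2.2.1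

theorem radius_lt_one {x : V} (hx : x ∈ ob.collar.target) : ob.radius x < 1 := by
  have h : ob.collar.symm x ∈ ob.collar.source := ob.collar.map_target hx
  rw [ob.collar_source] at h
  exact h

theorem collar_base_radius {x : V} (hx : x ∈ ob.collar.target) :
    ob.collar (ob.base x, (ob.collar.symm x).2) = x :=
  ob.collar.right_inv hx

theorem base_collar {b : B} {r : unitInterval} (hr : (r : ℝ) < 1) :
    ob.base (ob.collar (b, r)) = b :=
  congrArg Prod.fst (ob.collar.left_inv (ob.mem_collar_source hr))

theorem radius_collar {b : B} {r : unitInterval} (hr : (r : ℝ) < 1) :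
    ob.radius (ob.collar (b, r)) = r :=
  congrArg (fun z : B × unitInterval => (z.2 : ℝ))
    (ob.collar.left_inv (ob.mem_collar_source hr))

theorem eq_of_base_eq_of_radius_eq {x y : V} (hx : x ∈ ob.collar.target)
    (hy : y ∈ ob.collar.target) (hb : ob.base x = ob.base y) (hr : ob.radius x = ob.radius y) :
    x = y := by
  rw [← ob.collar_base_radius hx, ← ob.collar_base_radius hy, hb]
  exact congrArg (fun r => ob.collar (ob.base y, r)) (Subtype.ext hr)

theorem page_injective : Function.Injective ob.page := fun x y h =>
  (ob.map_injective x y 0 (by simp) 0 (by simp) h).1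

theorem contMDiff_page : ContMDiff (𝓡∂ (m + 1)) (𝓡 (m + 2)) ∞ ob.page :=
  ob.contMDiff_map.comp (contMDiff_id.prodMk contMDiff_const)

theorem contMDiffOn_collar_symm :
    ContMDiffOn (𝓡∂ (m + 1)) ((𝓡 m).prod (𝓡∂ 1)) ∞ ob.collar.symm ob.collar.target :=
  ob.collar.symm.contMDiffOn

theorem contMDiffAt_base {x : V} (hx : x ∈ ob.collar.target) :
    ContMDiffAt (𝓡∂ (m + 1)) (𝓡 m) ∞ ob.base x :=
  (ob.contMDiffOn_collar_symm.contMDiffAt (ob.collar.open_target.mem_nhds hx)).fst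

theorem contMDiffAt_radius {x : V} (hx : x ∈ ob.collar.target) :
    ContMDiffAt (𝓡∂ (m + 1)) 𝓘(ℝ, ℝ) ∞ ob.radius x :=
  ContMDiffAt.comp (g := (Subtype.val : unitInterval → ℝ)) x
    (contMDiff_subtypeVal_Icc (x := (0 : ℝ)) (y := 1)).contMDiffAt
    (ob.contMDiffOn_collar_symm.contMDiffAt (ob.collar.open_target.mem_nhds hx)).snd

/-- The inverse of the collar is a local diffeomorphism, so its two components together detect every
tangent vector. This reduces the immersion property on the collar to a computation in the radius. -/
theorem eq_zero_of_mfderiv_base_radius {x : V} (hx : x ∈ ob.collar.target)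
    {v : TangentSpace (𝓡∂ (m + 1)) x} (hb : mfderiv (𝓡∂ (m + 1)) (𝓡 m) ob.base x v = 0)
    (hr : mfderiv (𝓡∂ (m + 1)) 𝓘(ℝ, ℝ) ob.radius x v = 0) : v = 0 := by
  have hsm := ob.contMDiffOn_collar_symm.contMDiffAt (ob.collar.open_target.mem_nhds hx)
  have h1 : MDifferentiableAt (𝓡∂ (m + 1)) (𝓡∂ 1) (fun y => (ob.collar.symm y).2) x :=
    hsm.snd.mdifferentiableAt (by simp)
  have h2 : mfderiv (𝓡∂ (m + 1)) (𝓡∂ 1) (fun y => (ob.collar.symm y).2) x v = 0 := by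
    apply injective_mfderiv_subtypeVal_Icc
    rw [← mfderiv_comp_apply x _ h1]
    · exact hr
    · exact (contMDiff_subtypeVal_Icc (x := (0 : ℝ)) (y := 1) (n := ∞)).mdifferentiable
        (by simp) _
  have h3 : mfderiv (𝓡∂ (m + 1)) ((𝓡 m).prod (𝓡∂ 1)) ob.collar.symm x v = 0 := by
    have h4 : mfderiv (𝓡∂ (m + 1)) ((𝓡 m).prod (𝓡∂ 1))
        (fun y => (ob.base y, (ob.collar.symm y).2)) x v =
        (mfderiv (𝓡∂ (m + 1)) (𝓡 m) ob.base x v,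
          mfderiv (𝓡∂ (m + 1)) (𝓡∂ 1) (fun y => (ob.collar.symm y).2) x v) := by
      rw [mfderiv_prodMk ((ob.contMDiffAt_base hx).mdifferentiableAt (by simp)) h1]
      rfl
    rw [hb, h2] at h4
    exact h4
  have hmem : (ob.collar.symm x) ∈ ob.collar.source := ob.collar.map_target hx
  refine eq_zero_of_mfderiv_apply_eq_zero_of_leftInverse (g := ob.collar)
    (hsm.mdifferentiableAt (by simp))
    (ob.collar.mdifferentiableAt (by simp) hmem) ?_ h3
  filter_upwards [ob.collar.open_target.mem_nhds hx] with y hy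
  exact ob.collar.right_inv hy

open Classical in
/-- The map of the page that reparametrizes the collar by the first coordinate of a segment to a
rounded corner. -/
noncomputable def push (d s : ℝ) (x : V) : V :=
  if x ∈ ob.collar.target then
    ob.collar (ob.base x, projIcc 0 1 zero_le_one (segmentFst d s (ob.radius x)))
  else x

open Classical in
/-- The height of the pushed page. -/
noncomputable def height (d k s : ℝ) (x : V) : ℝ :=
  if x ∈ ob.collar.target then segmentSnd d k s (ob.radius x) else -(1 - s)

/-- The closed part of the collar outside of which the page is pushed to a single level. -/
def innerCollar (d : ℝ) : Set V := ob.collar '' {z | (z.2 : ℝ) ≤ 2 * d}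

variable {d k s : ℝ}

theorem segmentFst_radius_mem (hs : s ∈ Icc (0 : ℝ) 1) {x : V} (hx : x ∈ ob.collar.target) :
    segmentFst d s (ob.radius x) ∈ Ico (0 : ℝ) 1 :=
  ⟨segmentFst_nonneg hs (ob.radius_nonneg x),
    (segmentFst_le hs (ob.radius_nonneg x)).trans_lt (ob.radius_lt_one hx)⟩

theorem coe_projIcc_segmentFst (hs : s ∈ Icc (0 : ℝ) 1) {x : V} (hx : x ∈ ob.collar.target) :
    (projIcc (0 : ℝ) 1 zero_le_one (segmentFst d s (ob.radius x)) : ℝ) =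
      segmentFst d s (ob.radius x) := by
  rw [projIcc_of_mem _ (Ico_subset_Icc_self (ob.segmentFst_radius_mem hs hx))]

theorem projIcc_segmentFst_lt_one (hs : s ∈ Icc (0 : ℝ) 1) {x : V} (hx : x ∈ ob.collar.target) :
    (projIcc (0 : ℝ) 1 zero_le_one (segmentFst d s (ob.radius x)) : ℝ) < 1 := by
  rw [ob.coe_projIcc_segmentFst hs hx]
  exact (ob.segmentFst_radius_mem hs hx).2

theorem push_of_mem {x : V} (hx : x ∈ ob.collar.target) : ob.push d s x =
    ob.collar (ob.base x, projIcc 0 1 zero_le_one (segmentFst d s (ob.radius x))) :=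
  if_pos hx

theorem push_of_notMem {x : V} (hx : x ∉ ob.collar.target) : ob.push d s x = x := if_neg hx

theorem height_of_mem {x : V} (hx : x ∈ ob.collar.target) :
    ob.height d k s x = segmentSnd d k s (ob.radius x) := if_pos hx

theorem height_of_notMem {x : V} (hx : x ∉ ob.collar.target) : ob.height d k s x = -(1 - s) :=
  if_neg hx

theorem push_mem_target_iff (hs : s ∈ Icc (0 : ℝ) 1) (x : V) :
    ob.push d s x ∈ ob.collar.target ↔ x ∈ ob.collar.target := by
  by_cases hx : x ∈ ob.collar.target
  · rw [ob.push_of_mem hx]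
    exact iff_of_true (ob.collar_mem_target (ob.projIcc_segmentFst_lt_one hs hx)) hx
  · rw [ob.push_of_notMem hx]

/-- The collar of the zero page is the nonnegative real ray in the tube. In this form the projection
to `[0, 1]` disappears, and the smoothness of the pushed page can be read off. -/
theorem page_push_of_mem (hs : s ∈ Icc (0 : ℝ) 1) {x : V} (hx : x ∈ ob.collar.target) :
    ob.page (ob.push d s x) = ob.tube (ob.base x, ((segmentFst d s (ob.radius x) : ℝ) : ℂ)) := by
  rw [ob.push_of_mem hx, ob.page_collar (ob.projIcc_segmentFst_lt_one hs hx),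
    ob.coe_projIcc_segmentFst hs hx]

theorem innerCollar_subset_target (hd' : 2 * d < 1) : ob.innerCollar d ⊆ ob.collar.target := by
  rintro _ ⟨⟨b, r⟩, hr, rfl⟩
  exact ob.collar_mem_target (lt_of_le_of_lt hr hd')

/-- Needed for gluing: a point outside the open collar then has a neighbourhood that misses the
inner collar, and there the pushed page is unchanged and its height constant. -/
theorem isClosed_innerCollar [CompactSpace B] [T2Space V] (hd' : 2 * d < 1) :
    IsClosed (ob.innerCollar d) := by
  have h1 : IsClosed {z : B × unitInterval | (z.2 : ℝ) ≤ 2 * d} :=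
    isClosed_le (continuous_subtype_val.comp continuous_snd) continuous_const
  refine (h1.isCompact.image_of_continuousOn
    (ob.collar.contMDiffOn.continuousOn.mono ?_)).isClosed
  rintro ⟨b, r⟩ hr
  exact ob.mem_collar_source (lt_of_le_of_lt hr hd')

theorem two_mul_lt_radius {x : V} (hx : x ∈ ob.collar.target) (hx' : x ∉ ob.innerCollar d) :
    2 * d < ob.radius x := by
  by_contra! h
  exact hx' ⟨_, h, ob.collar_base_radius hx⟩

theorem push_of_notMem_innerCollar (hd : 0 < d) {x : V} (hx : x ∉ ob.innerCollar d) :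
    ob.push d s x = x := by
  by_cases hx' : x ∈ ob.collar.target
  · rw [ob.push_of_mem hx', segmentFst_of_ge hd (ob.two_mul_lt_radius hx' hx).le]
    conv_rhs => rw [← ob.collar_base_radius hx']
    congr 2
    exact projIcc_val zero_le_one (ob.collar.symm x).2
  · exact ob.push_of_notMem hx'

theorem height_of_notMem_innerCollar (hd : 0 < d) {x : V} (hx : x ∉ ob.innerCollar d) :
    ob.height d k s x = -(1 - s) := by
  by_cases hx' : x ∈ ob.collar.target
  · rw [ob.height_of_mem hx', segmentSnd_of_ge hd (ob.two_mul_lt_radius hx' hx).le]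
  · exact ob.height_of_notMem hx'

theorem push_zero (x : V) : ob.push d 0 x = x := by
  by_cases hx : x ∈ ob.collar.target
  · rw [ob.push_of_mem hx, segmentFst_zero_left]
    conv_rhs => rw [← ob.collar_base_radius hx]
    congr 2
    exact projIcc_val zero_le_one (ob.collar.symm x).2
  · exact ob.push_of_notMem hx

theorem height_zero (x : V) : ob.height d k 0 x = -1 := by
  by_cases hx : x ∈ ob.collar.target
  · simp [ob.height_of_mem hx, segmentSnd]
  · simp [ob.height_of_notMem hx]

theorem height_nonpos (hs : s ∈ Icc (0 : ℝ) 1) (x : V) : ob.height d k s x ≤ 0 := by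
  by_cases hx : x ∈ ob.collar.target
  · rw [ob.height_of_mem hx]
    exact segmentSnd_nonpos hs
  · rw [ob.height_of_notMem hx]
    linarith [hs.2]

theorem neg_one_le_height (hk : 0 < k) (hs : s ∈ Icc (0 : ℝ) 1) (x : V) :
    -1 ≤ ob.height d k s x := by
  by_cases hx : x ∈ ob.collar.target
  · rw [ob.height_of_mem hx]
    exact neg_one_le_segmentSnd hk hs (ob.radius_nonneg x)
  · rw [ob.height_of_notMem hx]
    linarith [hs.1]

theorem height_mem (hk : 0 < k) (hs : s ∈ Icc (0 : ℝ) 1) (x : V) :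
    ob.height d k s x ∈ Icc (-1 : ℝ) 1 :=
  ⟨ob.neg_one_le_height hk hs x, (ob.height_nonpos hs x).trans zero_le_one⟩

theorem radius_pos_of_interior {x : V} (hx : x ∈ ob.collar.target)
    (hi : x ∈ (𝓡∂ (m + 1)).interior V) : 0 < ob.radius x := by
  refine (ob.radius_nonneg x).lt_of_ne fun h => ?_
  rw [← ModelWithCorners.compl_boundary, ob.boundary_eq] at hi
  refine hi ⟨ob.base x, ?_⟩
  conv_rhs => rw [← ob.collar_base_radius hx]
  exact congrArg (fun r => ob.collar (ob.base x, r)) (Subtype.ext h)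

theorem neg_one_lt_height (hk : 0 < k) (hs : 0 < s) {x : V}
    (hi : x ∈ (𝓡∂ (m + 1)).interior V) : -1 < ob.height d k s x := by
  by_cases hx : x ∈ ob.collar.target
  · rw [ob.height_of_mem hx]
    exact neg_one_lt_segmentSnd hk hs (ob.radius_pos_of_interior hx hi)
  · rw [ob.height_of_notMem hx]
    linarith

theorem push_boundary {x : V} (hx : x ∈ (𝓡∂ (m + 1)).boundary V) :
    ob.push d s x = x := by
  rw [ob.boundary_eq] at hx
  obtain ⟨b, rfl⟩ := hx
  have h0 : ((0 : unitInterval) : ℝ) < 1 := by simp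
  rw [ob.push_of_mem (ob.collar_mem_target h0), ob.base_collar h0, ob.radius_collar h0]
  congr 2
  ext
  simp [segmentFst, cornerFst]

theorem height_boundary (hd : 0 < d) {x : V} (hx : x ∈ (𝓡∂ (m + 1)).boundary V) :
    ob.height d k s x = -1 := by
  rw [ob.boundary_eq] at hx
  obtain ⟨b, rfl⟩ := hx
  have h0 : ((0 : unitInterval) : ℝ) < 1 := by simp
  rw [ob.height_of_mem (ob.collar_mem_target h0), ob.radius_collar h0, segmentSnd,
    cornerSnd_of_le hd (by simpa using hd.le)]
  simp only [Icc.coe_zero, mul_zero, neg_zero, Real.exp_zero]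
  ring

/-- At `s = 1` the push alone collapses the radii up to `d` onto the boundary; the height tells
these points apart. -/
theorem eq_of_push_eq_of_height_eq (hd : 0 < d) (hk : 0 < k) (hs : s ∈ Icc (0 : ℝ) 1) {x y : V}
    (h1 : ob.push d s x = ob.push d s y) (h2 : ob.height d k s x = ob.height d k s y) :
    x = y := by
  have hiff : x ∈ ob.collar.target ↔ y ∈ ob.collar.target := by
    rw [← ob.push_mem_target_iff hs x, h1, ob.push_mem_target_iff hs y]
  by_cases hx : x ∈ ob.collar.target
  · have hy := hiff.1 hx
    rw [ob.push_of_mem hx, ob.push_of_mem hy] at h1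
    rw [ob.height_of_mem hx, ob.height_of_mem hy] at h2
    have h3 := ob.collar.injOn (ob.mem_collar_source (ob.projIcc_segmentFst_lt_one hs hx))
      (ob.mem_collar_source (ob.projIcc_segmentFst_lt_one hs hy)) h1
    have h4 : segmentFst d s (ob.radius x) = segmentFst d s (ob.radius y) := by
      rw [← ob.coe_projIcc_segmentFst hs hx, ← ob.coe_projIcc_segmentFst hs hy]
      exact congrArg (fun z : B × unitInterval => (z.2 : ℝ)) h3
    have h5 : ob.base x = ob.base y := (Prod.ext_iff.1 h3).1
    exact ob.eq_of_base_eq_of_radius_eq hx hy h5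
      (segment_injective hd hk hs (ob.radius_nonneg x) (ob.radius_nonneg y) h4 h2)
  · rwa [ob.push_of_notMem hx, ob.push_of_notMem (fun hy => hx (hiff.2 hy))] at h1

theorem contMDiffAt_param_radius {z : unitInterval × V} (hz : z.2 ∈ ob.collar.target) :
    ContMDiffAt ((𝓡∂ 1).prod (𝓡∂ (m + 1))) 𝓘(ℝ, ℝ × ℝ) ∞
      (fun w : unitInterval × V => ((w.1 : ℝ), ob.radius w.2)) z := by
  have h1 : ContMDiffAt ((𝓡∂ 1).prod (𝓡∂ (m + 1))) 𝓘(ℝ, ℝ) ∞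
      (fun w : unitInterval × V => (w.1 : ℝ)) z :=
    ContMDiffAt.comp (g := (Subtype.val : unitInterval → ℝ)) z
      (contMDiff_subtypeVal_Icc (x := (0 : ℝ)) (y := 1)).contMDiffAt contMDiffAt_fst
  have h2 : ContMDiffAt ((𝓡∂ 1).prod (𝓡∂ (m + 1))) 𝓘(ℝ, ℝ) ∞
      (fun w : unitInterval × V => ob.radius w.2) z :=
    ContMDiffAt.comp (g := ob.radius) z (ob.contMDiffAt_radius hz) contMDiffAt_snd
  exact h1.prodMk_space h2

section Smooth

variable [CompactSpace B] [T2Space V]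

theorem eventually_notMem_innerCollar (hd' : 2 * d < 1) {x : V} (hx : x ∉ ob.collar.target) :
    ∀ᶠ y in 𝓝 x, y ∉ ob.innerCollar d :=
  (ob.isClosed_innerCollar hd').isOpen_compl.mem_nhds fun h =>
    hx (ob.innerCollar_subset_target hd' h)

theorem contMDiff_page_push (hd : 0 < d) (hd' : 2 * d < 1) :
    ContMDiff ((𝓡∂ 1).prod (𝓡∂ (m + 1))) (𝓡 (m + 2)) ∞
      fun z : unitInterval × V => ob.page (ob.push d z.1 z.2) := by
  intro z
  by_cases hz : z.2 ∈ ob.collar.target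
  · have hev : ∀ᶠ w : unitInterval × V in 𝓝 z, w.2 ∈ ob.collar.target :=
      continuous_snd.continuousAt.eventually (ob.collar.open_target.mem_nhds hz)
    refine ContMDiffAt.congr_of_eventuallyEq (f := fun w : unitInterval × V =>
      ob.tube (ob.base w.2, ((segmentFst d w.1 (ob.radius w.2) : ℝ) : ℂ))) ?_ ?_
    · have h1 : ContMDiffAt ((𝓡∂ 1).prod (𝓡∂ (m + 1))) (𝓡 m) ∞
          (fun w : unitInterval × V => ob.base w.2) z :=
        ContMDiffAt.comp (g := ob.base) z (ob.contMDiffAt_base hz) contMDiffAt_snd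
      have h2 : ContMDiffAt ((𝓡∂ 1).prod (𝓡∂ (m + 1))) 𝓘(ℝ, ℂ) ∞
          (fun w : unitInterval × V => ((segmentFst d w.1 (ob.radius w.2) : ℝ) : ℂ)) z :=
        ContMDiffAt.comp (g := fun p : ℝ × ℝ => ((segmentFst d p.1 p.2 : ℝ) : ℂ)) z
          (Complex.ofRealCLM.contDiff.comp contDiff_segmentFst).contMDiff.contMDiffAt
          (ob.contMDiffAt_param_radius hz)
      refine ContMDiffAt.comp (g := ob.tube) z ?_ (h1.prodMk h2)
      refine ob.tube.contMDiffOn.contMDiffAt (ob.tube.open_source.mem_nhds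
        (ob.mem_tube_source ?_))
      have := ob.segmentFst_radius_mem (d := d) z.1.2 hz
      rw [Complex.norm_real, Real.norm_of_nonneg this.1]
      exact this.2
    · filter_upwards [hev] with w hw
      exact ob.page_push_of_mem w.1.2 hw
  · have hev := continuous_snd.continuousAt.eventually
      (ob.eventually_notMem_innerCollar hd' hz)
    refine ContMDiffAt.congr_of_eventuallyEq (f := fun w : unitInterval × V => ob.page w.2)
      (ContMDiffAt.comp (g := ob.page) z ob.contMDiff_page.contMDiffAt contMDiffAt_snd) ?_
    filter_upwards [hev] with w hw
    rw [ob.push_of_notMem_innerCollar hd hw]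

theorem contMDiff_height (hd : 0 < d) (hd' : 2 * d < 1) :
    ContMDiff ((𝓡∂ 1).prod (𝓡∂ (m + 1))) 𝓘(ℝ, ℝ) ∞
      fun z : unitInterval × V => ob.height d k z.1 z.2 := by
  intro z
  by_cases hz : z.2 ∈ ob.collar.target
  · have hev : ∀ᶠ w : unitInterval × V in 𝓝 z, w.2 ∈ ob.collar.target :=
      continuous_snd.continuousAt.eventually (ob.collar.open_target.mem_nhds hz)
    refine ContMDiffAt.congr_of_eventuallyEq (f := fun w : unitInterval × V =>
      segmentSnd d k w.1 (ob.radius w.2)) ?_ ?_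
    · exact ContMDiffAt.comp (g := fun p : ℝ × ℝ => segmentSnd d k p.1 p.2) z
        contDiff_segmentSnd.contMDiff.contMDiffAt (ob.contMDiffAt_param_radius hz)
    · filter_upwards [hev] with w hw
      exact ob.height_of_mem hw
  · have hev := continuous_snd.continuousAt.eventually
      (ob.eventually_notMem_innerCollar hd' hz)
    refine ContMDiffAt.congr_of_eventuallyEq (f := fun w : unitInterval × V => -(1 - (w.1 : ℝ)))
      ?_ ?_
    · have h1 : ContMDiffAt ((𝓡∂ 1).prod (𝓡∂ (m + 1))) 𝓘(ℝ, ℝ) ∞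
          (fun w : unitInterval × V => (w.1 : ℝ)) z :=
        ContMDiffAt.comp (g := (Subtype.val : unitInterval → ℝ)) z
          (contMDiff_subtypeVal_Icc (x := (0 : ℝ)) (y := 1)).contMDiffAt contMDiffAt_fst
      exact ContMDiffAt.comp (g := fun t : ℝ => -(1 - t)) z
        (contDiff_const.sub contDiff_id).neg.contMDiff.contMDiffAt h1
    · filter_upwards [hev] with w hw
      exact ob.height_of_notMem_innerCollar hd hw

end Smooth

/-- The isotopy from a page in the lowest level to a page with its boundary pulled down and its
corner rounded. -/
noncomputable def seifertIsotopy (d k s : ℝ) (x : V) : N × Icc (-1 : ℝ) 1 :=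
  (ob.page (ob.push d s x), projIcc (-1) 1 (Fact.out : (-1 : ℝ) < 1).le (ob.height d k s x))

theorem coe_seifertIsotopy_snd (hk : 0 < k) (hs : s ∈ Icc (0 : ℝ) 1) (x : V) :
    ((ob.seifertIsotopy d k s x).2 : ℝ) = ob.height d k s x := by
  rw [seifertIsotopy, projIcc_of_mem _ (ob.height_mem hk hs x)]

theorem seifertIsotopy_injective (hd : 0 < d) (hk : 0 < k) (hs : s ∈ Icc (0 : ℝ) 1) :
    Function.Injective (ob.seifertIsotopy d k s) := by
  intro x y h
  refine ob.eq_of_push_eq_of_height_eq hd hk hs (ob.page_injective (congrArg Prod.fst h)) ?_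
  rw [← ob.coe_seifertIsotopy_snd hk hs, ← ob.coe_seifertIsotopy_snd hk hs, h]

variable [CompactSpace B] [T2Space V]

theorem contMDiff_seifertIsotopy (hd : 0 < d) (hd' : 2 * d < 1) (hk : 0 < k) :
    ContMDiff ((𝓡∂ 1).prod (𝓡∂ (m + 1))) ((𝓡 (m + 2)).prod (𝓡∂ 1)) ∞
      fun z : unitInterval × V => ob.seifertIsotopy d k z.1 z.2 :=
  (ob.contMDiff_page_push hd hd').prodMk
    (contMDiff_projIcc_comp (ob.contMDiff_height hd hd') fun z => ob.height_mem hk z.1.2 z.2)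

theorem contMDiff_seifertIsotopy_right (hd : 0 < d) (hd' : 2 * d < 1) (hk : 0 < k)
    (hs : s ∈ Icc (0 : ℝ) 1) :
    ContMDiff (𝓡∂ (m + 1)) ((𝓡 (m + 2)).prod (𝓡∂ 1)) ∞ (ob.seifertIsotopy d k s) :=
  (ob.contMDiff_seifertIsotopy hd hd' hk).comp
    (contMDiff_const (c := (⟨s, hs⟩ : unitInterval)) |>.prodMk contMDiff_id)

/-- On the collar, the inverse of the tube and the level recover the base and both segment
coordinates, one of which has nonzero derivative in the radius. Off the collar, the point is
interior and the page is unmoved nearby, so a local inverse of the quotient map gives a left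
inverse. -/
theorem mfderiv_seifertIsotopy_injective (hd : 0 < d) (hd' : 2 * d < 1) (hk : 0 < k)
    (hs : s ∈ Icc (0 : ℝ) 1) (x : V) :
    Function.Injective (mfderiv (𝓡∂ (m + 1)) ((𝓡 (m + 2)).prod (𝓡∂ 1))
      (ob.seifertIsotopy d k s) x) := by
  rw [injective_iff_map_eq_zero]
  intro v hv
  have hF : MDifferentiableAt (𝓡∂ (m + 1)) ((𝓡 (m + 2)).prod (𝓡∂ 1))
      (ob.seifertIsotopy d k s) x :=
    (ob.contMDiff_seifertIsotopy_right hd hd' hk hs).mdifferentiable (by simp) x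
  by_cases hx : x ∈ ob.collar.target
  · have hev : ∀ᶠ y in 𝓝 x, y ∈ ob.collar.target := ob.collar.open_target.mem_nhds hx
    have hsrc : ∀ y ∈ ob.collar.target,
        (ob.base y, ((segmentFst d s (ob.radius y) : ℝ) : ℂ)) ∈ ob.tube.source := by
      intro y hy
      refine ob.mem_tube_source ?_
      have := ob.segmentFst_radius_mem (d := d) hs hy
      rw [Complex.norm_real, Real.norm_of_nonneg this.1]
      exact this.2
    have hfst : ∀ y ∈ ob.collar.target, ob.tube.symm (ob.seifertIsotopy d k s y).1 =
        (ob.base y, ((segmentFst d s (ob.radius y) : ℝ) : ℂ)) := by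
      intro y hy
      rw [seifertIsotopy, ob.page_push_of_mem hs hy]
      exact ob.tube.left_inv (hsrc y hy)
    have htgt : (ob.seifertIsotopy d k s x).1 ∈ ob.tube.target := by
      rw [seifertIsotopy, ob.page_push_of_mem hs hx]
      exact ob.tube.map_source (hsrc x hx)
    have hsymm : ContMDiffAt ((𝓡 (m + 2)).prod (𝓡∂ 1)) ((𝓡 m).prod 𝓘(ℝ, ℂ)) ∞
        (fun z : N × Icc (-1 : ℝ) 1 => ob.tube.symm z.1) (ob.seifertIsotopy d k s x) :=
      ContMDiffAt.comp (g := ob.tube.symm) _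
        (ob.tube.symm.contMDiffOn.contMDiffAt (ob.tube.open_target.mem_nhds htgt)) contMDiffAt_fst
    have hrad := (ob.contMDiffAt_radius hx).mdifferentiableAt (n := ∞) (by simp)
    refine ob.eq_zero_of_mfderiv_base_radius hx ?_ ?_
    · refine mfderiv_apply_eq_zero_of_comp (g := fun z => (ob.tube.symm z.1).1) hF
        (hsymm.fst.mdifferentiableAt (by simp)) ?_ hv
      filter_upwards [hev] with y hy
      exact congrArg Prod.fst (hfst y hy)
    · have hA : mfderiv (𝓡∂ (m + 1)) 𝓘(ℝ, ℝ) (segmentFst d s ∘ ob.radius) x v = 0 := by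
        refine mfderiv_apply_eq_zero_of_comp (g := fun z => (ob.tube.symm z.1).2.re) hF
          ?_ ?_ hv
        · refine ContMDiffAt.mdifferentiableAt (n := ∞) ?_ (by simp)
          exact ContMDiffAt.comp (g := Complex.re) _
            Complex.reCLM.contDiff.contMDiff.contMDiffAt hsymm.snd
        · filter_upwards [hev] with y hy
          exact (congrArg (fun z : B × ℂ => z.2.re) (hfst y hy)).trans (Complex.ofReal_re _)
      have hB : mfderiv (𝓡∂ (m + 1)) 𝓘(ℝ, ℝ) (segmentSnd d k s ∘ ob.radius) x v = 0 := by
        refine mfderiv_apply_eq_zero_of_comp (g := fun z => (z.2 : ℝ)) hF ?_ ?_ hv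
        · refine ContMDiffAt.mdifferentiableAt (n := ∞) ?_ (by simp)
          exact ContMDiffAt.comp (g := (Subtype.val : Icc (-1 : ℝ) 1 → ℝ)) _
            contMDiff_subtypeVal_Icc.contMDiffAt contMDiffAt_snd
        · filter_upwards [hev] with y hy
          exact (ob.coe_seifertIsotopy_snd hk hs y).trans (ob.height_of_mem hy)
      have hA' : DifferentiableAt ℝ (segmentFst d s) (ob.radius x) :=
        (contDiff_segmentFst.comp (contDiff_const.prodMk contDiff_id)).differentiable
          (by simp) _
      have hB' : DifferentiableAt ℝ (segmentSnd d k s) (ob.radius x) :=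
        (contDiff_segmentSnd.comp (contDiff_const.prodMk contDiff_id)).differentiable
          (by simp) _
      rcases segment_deriv_ne_zero hd hk hs (ob.radius_nonneg x) with h | h
      · exact mfderiv_apply_eq_zero_of_deriv_ne_zero hrad hA' h hA
      · exact mfderiv_apply_eq_zero_of_deriv_ne_zero hrad hB' h hB
  · have hi : x ∈ (𝓡∂ (m + 1)).interior V := by
      rw [← ModelWithCorners.compl_boundary]
      exact fun h => hx (ob.boundary_subset_collar_target h)
    have hloc := ob.isLocalDiffeomorphAt_map x hi 0
    have hFx : (ob.seifertIsotopy d k s x).1 = ob.map x 0 := by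
      rw [seifertIsotopy, ob.push_of_notMem hx]
      rfl
    refine eq_zero_of_mfderiv_apply_eq_zero_of_leftInverse
      (g := fun z => (hloc.localInverse z.1).1) hF ?_ ?_ hv
    · refine ContMDiffAt.mdifferentiableAt (n := ∞) ?_ (by simp)
      have : ContMDiffAt ((𝓡 (m + 2)).prod (𝓡∂ 1)) ((𝓡∂ (m + 1)).prod 𝓘(ℝ, ℝ)) ∞
          (fun z : N × Icc (-1 : ℝ) 1 => hloc.localInverse z.1) (ob.seifertIsotopy d k s x) :=
        ContMDiffAt.comp_of_eq (g := hloc.localInverse) hloc.localInverse_contMDiffAt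
          contMDiffAt_fst hFx
      exact this.fst
    · have hcont : ContinuousAt (fun y : V => (y, (0 : ℝ))) x := by fun_prop
      filter_upwards [ob.eventually_notMem_innerCollar hd' hx,
        hcont.eventually hloc.localInverse_eventuallyEq_left] with y hy hy'
      have : (ob.seifertIsotopy d k s y).1 = ob.map y 0 := by
        rw [seifertIsotopy, ob.push_of_notMem_innerCollar hd hy]
        rfl
      simp only [Function.comp_apply, this]
      exact congrArg Prod.fst hy'

theorem isSmoothEmb_seifertIsotopy [CompactSpace V] [T2Space N] (hd : 0 < d) (hd' : 2 * d < 1)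
    (hk : 0 < k) (hs : s ∈ Icc (0 : ℝ) 1) :
    IsSmoothEmb (𝓡∂ (m + 1)) ((𝓡 (m + 2)).prod (𝓡∂ 1)) (ob.seifertIsotopy d k s) where
  contMDiff := ob.contMDiff_seifertIsotopy_right hd hd' hk hs
  injective_mfderiv := ob.mfderiv_seifertIsotopy_injective hd hd' hk hs
  isEmbedding := ((ob.contMDiff_seifertIsotopy_right hd hd' hk hs).continuous.isClosedEmbedding
    (ob.seifertIsotopy_injective hd hk hs)).isEmbedding

end OpenBook

/-! ### The damped rotation of the levels -/

/-- A smooth function on `[-1, 1]` that vanishes at the ends and is `1` on `[-1/2, 1/2]`. -/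
noncomputable def plateau (u : ℝ) : ℝ := Real.smoothTransition (2 * (1 - u ^ 2))

theorem contDiff_plateau : ContDiff ℝ ∞ plateau :=
  Real.smoothTransition.contDiff.comp
    (contDiff_const.mul (contDiff_const.sub (contDiff_id.pow 2)))

theorem plateau_eq_one {u : ℝ} (h : |u| ≤ 1 / 2) : plateau u = 1 := by
  have := abs_le.1 h
  exact Real.smoothTransition.one_of_one_le (by nlinarith)

theorem plateau_neg_one : plateau (-1) = 0 := by simp [plateau]

theorem plateau_one : plateau 1 = 0 := by simp [plateau]

namespace OpenBook

variable {m : ℕ} {B V N : Type*}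
    [TopologicalSpace B] [ChartedSpace (EuclideanSpace ℝ (Fin m)) B]
    [TopologicalSpace V] [ChartedSpace (EuclideanHalfSpace (m + 1)) V]
    [TopologicalSpace N] [ChartedSpace (EuclideanSpace ℝ (Fin (m + 2))) N]
    {φ : V ≃ₘ^∞⟮𝓡∂ (m + 1), 𝓡∂ (m + 1)⟯ V} (ob : OpenBook m B V N φ)

theorem contMDiff_flow_comp {E H : Type*} [NormedAddCommGroup E] [NormedSpace ℝ E]
    [TopologicalSpace H] {I : ModelWithCorners ℝ E H} {X : Type*} [TopologicalSpace X]
    [ChartedSpace H X] {f : X → ℝ} {g : X → N} (hf : ContMDiff I 𝓘(ℝ, ℝ) ∞ f)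
    (hg : ContMDiff I (𝓡 (m + 2)) ∞ g) :
    ContMDiff I (𝓡 (m + 2)) ∞ fun x => ob.flow (f x) (g x) :=
  ob.contMDiff_flow.comp (hf.prodMk hg)

variable {a c : ℝ} [Fact (a < c)]

theorem contMDiff_levelFlow {f : ℝ → ℝ} (hf : ContDiff ℝ ∞ f) :
    ContMDiff ((𝓡 (m + 2)).prod (𝓡∂ 1)) ((𝓡 (m + 2)).prod (𝓡∂ 1)) ∞
      fun z : N × Icc a c => (ob.flow (f z.2) z.1, z.2) :=
  (ob.contMDiff_flow_comp (hf.contMDiff.comp (contMDiff_subtypeVal_Icc.comp contMDiff_snd))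
    contMDiff_fst).prodMk contMDiff_snd

/-- The diffeomorphism of `N × [a, c]` that is the flow for the time `f u` in the level `u`. -/
noncomputable def levelFlow (f : ℝ → ℝ) (hf : ContDiff ℝ ∞ f) :
    (N × Icc a c) ≃ₘ^∞⟮(𝓡 (m + 2)).prod (𝓡∂ 1), (𝓡 (m + 2)).prod (𝓡∂ 1)⟯ (N × Icc a c) where
  toFun z := (ob.flow (f z.2) z.1, z.2)
  invFun z := (ob.flow (-f z.2) z.1, z.2)
  left_inv z := by simp [flow_flow, flow_zero]
  right_inv z := by simp [flow_flow, flow_zero]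
  contMDiff_toFun := ob.contMDiff_levelFlow hf
  contMDiff_invFun := ob.contMDiff_levelFlow hf.neg

/-- The isotopy of `N × [a, c]` that rotates the pages, damped by the function `f` of the level. -/
noncomputable def rotation (f : ℝ → ℝ) (hf : ContDiff ℝ ∞ f) (s : unitInterval) :
    (N × Icc a c) ≃ₘ^∞⟮(𝓡 (m + 2)).prod (𝓡∂ 1), (𝓡 (m + 2)).prod (𝓡∂ 1)⟯ (N × Icc a c) :=
  ob.levelFlow (fun u => s * f u) (contDiff_const.mul hf)

theorem rotation_apply {f : ℝ → ℝ} (hf : ContDiff ℝ ∞ f) (s : unitInterval) (z : N × Icc a c) :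
    ob.rotation f hf s z = (ob.flow (s * f z.2) z.1, z.2) := rfl

/-- As `N` has no boundary, the boundary of the product consists of the two end levels, where the
damping leaves flow time zero. -/
theorem isIsotopyRelBoundary_rotation {f : ℝ → ℝ} (hf : ContDiff ℝ ∞ f) (ha : f a = 0)
    (hc : f c = 0) :
    IsIsotopyRelBoundary ((𝓡 (m + 2)).prod (𝓡∂ 1)) (ob.rotation (a := a) (c := c) f hf) where
  contMDiff := by
    have h1 : ContMDiff ((𝓡∂ 1).prod ((𝓡 (m + 2)).prod (𝓡∂ 1))) 𝓘(ℝ, ℝ) ∞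
        fun w : unitInterval × (N × Icc a c) => (w.1 : ℝ) :=
      contMDiff_subtypeVal_Icc.comp contMDiff_fst
    have h2 : ContMDiff ((𝓡∂ 1).prod ((𝓡 (m + 2)).prod (𝓡∂ 1))) 𝓘(ℝ, ℝ) ∞
        fun w : unitInterval × (N × Icc a c) => f w.2.2 :=
      hf.contMDiff.comp (contMDiff_subtypeVal_Icc.comp (contMDiff_snd.comp contMDiff_snd))
    exact (ob.contMDiff_flow_comp (h1.mul h2) (contMDiff_fst.comp contMDiff_snd)).prodMk
      (contMDiff_snd.comp contMDiff_snd)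
  fixes_boundary := by
    rintro s ⟨y, u⟩ hz
    rw [boundary_product] at hz
    have hfu : f u = 0 := by
      rcases hz.2 with h | h
      · exact (congrArg (fun w : Icc a c => f w) h).trans ha
      · exact (congrArg (fun w : Icc a c => f w) h).trans hc
    rw [rotation_apply, hfu, mul_zero, flow_zero]

theorem mem_interior_prod_Icc {z : N × Icc a c} (h1 : a < z.2) (h2 : (z.2 : ℝ) < c) :
    z ∈ ((𝓡 (m + 2)).prod (𝓡∂ 1)).interior (N × Icc a c) := by
  rw [ModelWithCorners.interior_prod]
  refine ⟨?_, Icc_isInteriorPoint_interior ⟨h1, h2⟩⟩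
  rw [ModelWithCorners.interior_eq_univ]
  trivial

/-! ### The bent page near the corner and its rotation -/

theorem page_image_boundary :
    ob.page '' (𝓡∂ (m + 1)).boundary V = range fun b : B => ob.tube (b, 0) := by
  rw [ob.boundary_eq, ← range_comp]
  congr 1
  ext b
  have := ob.page_collar (b := b) (r := 0) (by simp)
  simpa using this

/-- An open neighbourhood of the corner contains a uniform tubular one. -/
theorem exists_tube_prod_subset [CompactSpace B] {W : Set (N × Icc (-1 : ℝ) 1)} (hW : IsOpen W)
    (hcorner : seifertCorner m ob.page 0 ⊆ W) :
    ∃ ε > 0, ∀ (b : B) (z : ℂ) (u : Icc (-1 : ℝ) 1), ‖z‖ < ε → |(u : ℝ)| < ε →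
      (ob.tube (b, z), u) ∈ W := by
  have hloc : ∀ b ∈ (univ : Set B), ∀ᶠ p : (ℂ × Icc (-1 : ℝ) 1) × B in
      𝓝 (((0 : ℂ), (⟨0, by norm_num⟩ : Icc (-1 : ℝ) 1)), b), (ob.tube (p.2, p.1.1), p.1.2) ∈ W := by
    intro b _
    have hc : ContinuousAt ob.tube (b, 0) :=
      (ob.tube.contMDiffOn.contMDiffAt (ob.tube.open_source.mem_nhds
        (ob.mem_tube_source (by simp)))).continuousAt
    have hc' : ContinuousAt (fun p : (ℂ × Icc (-1 : ℝ) 1) × B => (ob.tube (p.2, p.1.1), p.1.2))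
        (((0 : ℂ), (⟨0, by norm_num⟩ : Icc (-1 : ℝ) 1)), b) := by
      refine ContinuousAt.prodMk (ContinuousAt.comp (g := ob.tube)
        (f := fun p : (ℂ × Icc (-1 : ℝ) 1) × B => (p.2, p.1.1)) hc ?_) ?_ <;> fun_prop
    refine hc'.eventually (hW.mem_nhds (hcorner ⟨?_, rfl⟩))
    rw [page_image_boundary]
    exact ⟨b, rfl⟩
  have h := isCompact_univ.eventually_forall_of_forall_eventually
    -- Compactness of the binding turns the neighbourhoods at its single points into one radius.
    (P := fun (p : ℂ × Icc (-1 : ℝ) 1) (b : B) => (ob.tube (b, p.1), p.2) ∈ W) hloc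
  obtain ⟨ε, hε, h⟩ := Metric.eventually_nhds_iff.1 h
  refine ⟨ε, hε, fun b z u hz hu => h (y := (z, u)) ?_ b (mem_univ b)⟩
  rw [Prod.dist_eq, max_lt_iff, Subtype.dist_eq, Real.dist_eq]
  simpa using ⟨hz, hu⟩

variable {d k : ℝ}

theorem segmentFst_one (r : ℝ) : segmentFst d 1 r = cornerFst d r := by simp [segmentFst]

theorem segmentSnd_one (r : ℝ) : segmentSnd d k 1 r = cornerSnd d k r := by simp [segmentSnd]

theorem seifertIsotopy_one_of_notMem (hd : 0 < d) {x : V} (hx : x ∉ ob.innerCollar d) :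
    ob.seifertIsotopy d k 1 x = (ob.page x, ⟨0, by norm_num⟩) := by
  rw [seifertIsotopy, ob.push_of_notMem_innerCollar hd hx, ob.height_of_notMem_innerCollar hd hx]
  refine congrArg (Prod.mk _) (Subtype.ext ?_)
  simp [coe_projIcc]

theorem seifertIsotopy_one_collar (hk : 0 < k) {b : B} {r : unitInterval} (hr : (r : ℝ) < 1) :
    (ob.seifertIsotopy d k 1 (ob.collar (b, r))).1 = ob.tube (b, ((cornerFst d r : ℝ) : ℂ)) ∧
      ((ob.seifertIsotopy d k 1 (ob.collar (b, r))).2 : ℝ) = cornerSnd d k r := by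
  have h1 : (1 : ℝ) ∈ Icc (0 : ℝ) 1 := by simp
  have hx := ob.collar_mem_target (b := b) hr
  rw [ob.coe_seifertIsotopy_snd hk h1, ob.height_of_mem hx, seifertIsotopy,
    ob.page_push_of_mem h1 hx, ob.base_collar hr, ob.radius_collar hr, segmentFst_one,
    segmentSnd_one]
  exact ⟨rfl, rfl⟩

/-- Outside a neighbourhood of the corner, the end of the isotopy is the union of the page and the
cylinder on the binding. -/
theorem range_seifertIsotopy_diff (hd : 0 < d) (hd' : 2 * d < 1) (hk : 0 < k) {ε : ℝ}
    (hdε : 2 * d < ε) (hkε : Real.exp (-(k * d)) < ε) {W : Set (N × Icc (-1 : ℝ) 1)}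
    (hW : ∀ (b : B) (z : ℂ) (u : Icc (-1 : ℝ) 1), ‖z‖ < ε → |(u : ℝ)| < ε →
      (ob.tube (b, z), u) ∈ W) :
    range (ob.seifertIsotopy d k 1) \ W = seifertSet m ob.page 0 \ W := by
  have hε : 0 < ε := by linarith
  ext ⟨y, u⟩
  refine and_congr_left fun hnW => ⟨?_, ?_⟩
  · rintro ⟨x, hx⟩
    by_cases hxC : x ∈ ob.innerCollar d
    · obtain ⟨⟨b, r⟩, hr, rfl⟩ := hxC
      replace hr : (r : ℝ) ≤ 2 * d := hr
      obtain ⟨h1, h2⟩ := ob.seifertIsotopy_one_collar (d := d) (b := b) hk (hr.trans_lt hd')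
      rw [hx] at h1 h2
      simp only at h1 h2
      subst h1
      rcases le_total (r : ℝ) d with hrd | hrd
      · right
        refine ⟨?_, h2.trans_le cornerSnd_nonpos⟩
        rw [page_image_boundary, cornerFst_of_le hd hrd]
        exact ⟨b, by simp⟩
      -- For `d ≤ r ≤ 2 * d` the curve is in its rounded stretch, which lies within `ε` of the
      -- corner and hence in `W`.
      · refine absurd (hW b _ u ?_ ?_) hnW
        · rw [Complex.norm_real, Real.norm_of_nonneg (cornerFst_nonneg r.2.1)]
          exact (cornerFst_le r.2.1).trans_lt (hr.trans_lt hdε)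
        · rw [h2, abs_of_nonpos cornerSnd_nonpos]
          have : Real.exp (-(k * r)) ≤ Real.exp (-(k * d)) := by gcongr
          linarith [neg_exp_le_cornerSnd (d := d) (k := k) (r := r)]
    · left
      rw [ob.seifertIsotopy_one_of_notMem hd hxC, Prod.mk.injEq] at hx
      exact ⟨⟨x, hx.1⟩, congrArg Subtype.val hx.2.symm⟩
  · rintro (⟨⟨x, rfl⟩, hu⟩ | ⟨hy, hu⟩)
    · replace hu : (u : ℝ) = 0 := hu
      refine ⟨x, ?_⟩
      by_cases hxC : x ∈ ob.innerCollar d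
      · obtain ⟨⟨b, r⟩, hr, rfl⟩ := hxC
        replace hr : (r : ℝ) ≤ 2 * d := hr
        rw [ob.page_collar (hr.trans_lt hd')] at hnW
        refine absurd (hW b _ u ?_ (by simpa [hu] using hε)) hnW
        rw [Complex.norm_real, Real.norm_of_nonneg r.2.1]
        exact hr.trans_lt hdε
      · rw [ob.seifertIsotopy_one_of_notMem hd hxC]
        exact Prod.ext rfl (Subtype.ext hu.symm)
    · replace hu : (u : ℝ) ≤ 0 := hu
      rw [page_image_boundary] at hy
      obtain ⟨b, rfl⟩ := hy
      -- A point of the cylinder outside `W` is at depth at least `ε`, hence below the place where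
      -- the rounding begins.
      have hu' : ε ≤ -(u : ℝ) := by
        by_contra! h
        exact hnW (hW b 0 u (by simpa using hε) (by rwa [abs_of_nonpos hu]))
      have hupos : 0 < -(u : ℝ) := hε.trans_le hu'
      -- The solution of `-exp (-(k * r)) = u`: the radius that the vertical part of the curve sends
      -- to level `u`.
      set r : ℝ := -Real.log (-u) / k with hr
      have hkr : -(k * r) = Real.log (-u) := by
        rw [hr]
        field_simp
      have hr0 : 0 ≤ r :=
        div_nonneg (neg_nonneg.2 (Real.log_nonpos hupos.le (by linarith [u.2.1]))) hk.le
      have hrd : r ≤ d := by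
        by_contra! h
        have h1 : Real.exp (-(k * r)) ≤ Real.exp (-(k * d)) := by gcongr
        rw [hkr, Real.exp_log hupos] at h1
        linarith
      have hr1 : r < 1 := by linarith
      obtain ⟨h1, h2⟩ :=
        ob.seifertIsotopy_one_collar (d := d) (b := b) (r := ⟨r, hr0, hr1.le⟩) hk hr1
      refine ⟨ob.collar (b, ⟨r, hr0, hr1.le⟩), Prod.ext ?_ (Subtype.ext ?_)⟩
      · rw [h1, cornerFst_of_le hd hrd]
        simp
      · rw [h2, cornerSnd_of_le hd hrd]
        change -Real.exp (-(k * r)) = u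
        rw [hkr, Real.exp_log hupos, neg_neg]

theorem isSeifertTypeEmbedding [CompactSpace B] [T2Space V] [CompactSpace V] [T2Space N]
    (hd : 0 < d) (hd' : 2 * d < 1) (hk : 0 < k) {ε : ℝ}
    (hdε : 2 * d < ε) (hkε : Real.exp (-(k * d)) < ε) {W : Set (N × Icc (-1 : ℝ) 1)}
    (hW : ∀ (b : B) (z : ℂ) (u : Icc (-1 : ℝ) 1), ‖z‖ < ε → |(u : ℝ)| < ε →
      (ob.tube (b, z), u) ∈ W) :
    IsSeifertTypeEmbedding m ob.page 0 W (ob.seifertIsotopy d k 1) where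
  exists_isotopy := by
    refine ⟨fun s => ob.seifertIsotopy d k s, ob.contMDiff_seifertIsotopy hd hd' hk,
      fun s => ob.isSmoothEmb_seifertIsotopy hd hd' hk s.2, fun x => ⟨?_, ?_⟩,
      fun s x hx => ⟨?_, ?_⟩, fun s hs x hx => ?_, fun s x => ?_, rfl⟩
    · exact congrArg ob.page (ob.push_zero x)
    · exact (ob.coe_seifertIsotopy_snd hk (0 : unitInterval).2 x).trans (ob.height_zero x)
    · exact congrArg ob.page (ob.push_boundary hx)
    · exact (ob.coe_seifertIsotopy_snd hk s.2 x).trans (ob.height_boundary hd hx)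
    · refine mem_interior_prod_Icc ?_ ?_
      · rw [ob.coe_seifertIsotopy_snd hk s.2]
        exact ob.neg_one_lt_height hk hs hx
      · rw [ob.coe_seifertIsotopy_snd hk s.2]
        exact (ob.height_nonpos s.2 x).trans_lt one_pos
    · exact (ob.coe_seifertIsotopy_snd hk s.2 x).trans_le (ob.height_nonpos s.2 x)
  fst_mem x := ⟨_, rfl⟩
  range_diff := ob.range_seifertIsotopy_diff hd hd' hk hdε hkε hW

/-- If `φ x` is in the collar, then `φ` fixes it, and injectivity of `φ` gives `φ x = x`. -/
theorem monodromy_mem_target_iff (x : V) : φ x ∈ ob.collar.target ↔ x ∈ ob.collar.target := by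
  refine ⟨fun h => ?_, fun h => by rwa [ob.monodromy_collar x h]⟩
  have h1 : φ x = x := φ.injective (ob.monodromy_collar _ h)
  rwa [h1] at h

theorem rotation_one_seifertIsotopy (hd : 0 < d) (hd' : 2 * d < 1) (hk : 0 < k)
    (hkd : Real.exp (-(k * d)) ≤ 1 / 2) (x : V) :
    ob.rotation plateau contDiff_plateau 1 (ob.seifertIsotopy d k 1 x) =
      ob.seifertIsotopy d k 1 (φ x) := by
  rw [rotation_apply]
  by_cases hxC : x ∈ ob.innerCollar d
  · rw [ob.monodromy_collar x (ob.innerCollar_subset_target hd' hxC)]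
    obtain ⟨⟨b, r⟩, hr, rfl⟩ := hxC
    replace hr : (r : ℝ) ≤ 2 * d := hr
    obtain ⟨h1, h2⟩ := ob.seifertIsotopy_one_collar (d := d) (b := b) hk (hr.trans_lt hd')
    refine Prod.ext ?_ rfl
    simp only [h1, h2]
    rcases le_total (r : ℝ) d with hrd | hrd
    -- The vertical part lies over the binding, so the value of the damping function does not
    -- matter.
    · rw [cornerFst_of_le hd hrd, Complex.ofReal_zero, flow_tube_zero]
    -- The rounded part has depth at most `exp (-(k * d)) ≤ 1 / 2`, where the damping function is
    -- `1`: the rotation is a full turn.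
    · rw [plateau_eq_one, ob.flow_tube]
      · simp [Complex.exp_two_pi_mul_I]
      · rw [Complex.norm_real, Real.norm_of_nonneg (cornerFst_nonneg r.2.1)]
        exact (cornerFst_le r.2.1).trans_lt (hr.trans_lt hd')
      · rw [abs_of_nonpos cornerSnd_nonpos]
        have : Real.exp (-(k * r)) ≤ Real.exp (-(k * d)) := by gcongr
        linarith [neg_exp_le_cornerSnd (d := d) (k := k) (r := r)]
  · have hxC' : φ x ∉ ob.innerCollar d := by
      intro h
      have h1 := ob.innerCollar_subset_target hd' h
      rw [ob.monodromy_collar x ((ob.monodromy_mem_target_iff x).1 h1)] at h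
      exact hxC h
    rw [ob.seifertIsotopy_one_of_notMem hd hxC, ob.seifertIsotopy_one_of_notMem hd hxC',
      plateau_eq_one (by norm_num)]
    simp [flow_one_page]

end OpenBook

theorem proposition2p3 {m : ℕ} {B V N : Type*}
    [TopologicalSpace B] [ChartedSpace (EuclideanSpace ℝ (Fin m)) B]
    [IsManifold (𝓡 m) ∞ B] [T2Space B] [CompactSpace B]
    [TopologicalSpace V] [ChartedSpace (EuclideanHalfSpace (m + 1)) V]
    [IsManifold (𝓡∂ (m + 1)) ∞ V] [T2Space V] [CompactSpace V]
    [TopologicalSpace N] [ChartedSpace (EuclideanSpace ℝ (Fin (m + 2))) N]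
    [IsManifold (𝓡 (m + 2)) ∞ N] [T2Space N] [CompactSpace N]
    (φ : V ≃ₘ^∞⟮𝓡∂ (m + 1), 𝓡∂ (m + 1)⟯ V)
    (ob : OpenBook m B V N φ)
    (W : Set (N × Icc (-1 : ℝ) 1)) (hW : IsOpen W)
    (hcorner : seifertCorner m ob.page 0 ⊆ W) :
    ∃ h : V → N × Icc (-1 : ℝ) 1,
      IsSeifertTypeEmbedding m ob.page 0 W h ∧
      ∃ Γ : unitInterval → (N × Icc (-1 : ℝ) 1) ≃ₘ^∞⟮(𝓡 (m + 2)).prod (𝓡∂ 1),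
          (𝓡 (m + 2)).prod (𝓡∂ 1)⟯ (N × Icc (-1 : ℝ) 1),
        IsIsotopyRelBoundary ((𝓡 (m + 2)).prod (𝓡∂ 1)) Γ ∧
        (∀ z, Γ 0 z = z) ∧
        ∀ x, Γ 1 (h x) = h (φ x) := by
  obtain ⟨ε, hε, hWε⟩ := ob.exists_tube_prod_subset hW hcorner
  -- The bound by `ε` keeps the rounding inside `W`, and the bound by `1` keeps it inside the
  -- collar.
  obtain ⟨d, hd, hdlt⟩ : ∃ d : ℝ, 0 < d ∧ 2 * d < min ε 1 :=
    ⟨min ε 1 / 4, by positivity, by linarith [lt_min hε one_pos]⟩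
  -- A steep exponential lifts the start of the rounding both into `W` and into the levels where
  -- `plateau` is `1`.
  obtain ⟨k, hk, hkε, hkd⟩ : ∃ k : ℝ, 0 < k ∧ Real.exp (-(k * d)) < ε ∧
      Real.exp (-(k * d)) ≤ 1 / 2 := by
    have ht : Filter.Tendsto (fun k : ℝ => Real.exp (-(k * d))) Filter.atTop (𝓝 0) :=
      Real.tendsto_exp_neg_atTop_nhds_zero.comp (Filter.tendsto_id.atTop_mul_const hd)
    exact ((Filter.eventually_gt_atTop (0 : ℝ)).and ((ht.eventually_lt_const hε).and
      (ht.eventually_le_const (by norm_num : (0 : ℝ) < 1 / 2)))).exists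
  have hdε : 2 * d < ε := hdlt.trans_le (min_le_left _ _)
  have hd' : 2 * d < 1 := hdlt.trans_le (min_le_right _ _)
  refine ⟨ob.seifertIsotopy d k 1, ob.isSeifertTypeEmbedding hd hd' hk hdε hkε hWε,
    ob.rotation plateau contDiff_plateau,
    ob.isIsotopyRelBoundary_rotation contDiff_plateau plateau_neg_one plateau_one, fun z => ?_,
    ob.rotation_one_seifertIsotopy hd hd' hk hkd⟩
  rw [ob.rotation_apply]
  simp [ob.flow_zero]
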